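/- Let $k$ be a field, $R=k[x_1,\dots,x_r]$, and let $I\subseteq R$ be a monomial ideal of codimension (height) two such that $R/I$ is Cohen–Macaulay. Then there is a monomial ideal $J\subseteq R$ such that $\sqrt J=\sqrt I$, the ring $R/J$ is Cohen–Macaulay, $J$ is generically a complete intersection (for every associated prime $P$ of $R/J$, the ideal $J_P$ is generated by a regular sequence of $R_P$), and all minimal monomial generators of $J$ have the same degree. Moreover, $J$ can be chosen to be the ideal of maximal minors of a matrix $h(\varphi)$ of the following kind. The matrix $\varphi$ is an $(m+1)\times m$ Hilbert–Burch matrix of $\sqrt I$, i.e. its signed maximal minors $f_0,\dots,f_m$ form a minimal generating set of $\sqrt I$ and the sequence $0\to R^{m}\xrightarrow{\varphi}R^{m+1}\xrightarrow{(f_0,\dots,f_m)}R\to R/\sqrt I\to 0$ is exact; each column of $\varphi$ has exactly two non-zero entries, and these are non-zero scalar multiples of monomials. The matrix $h(\varphi)$ is obtained from $\varphi$ by homogenizing the columns: in each column the entry of smaller degree (if the degrees differ) is replaced by a monomial of the larger degree, with the same scalar coefficient, by raising exponents of variables that already occur in it. -/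

import Mathlib

/-- A Noetherian local ring is Cohen–Macaulay if its depth equals its Krull dimension, that is, if
its maximal ideal contains a regular sequence whose length is the Krull dimension of the ring. -/
structure IsCohenMacaulayLocalRing (A : Type*) [CommRing A] [IsLocalRing A] : Prop where
  noetherian : IsNoetherianRing A
  exists_isRegular : ∃ rs : List A, (∀ x ∈ rs, x ∈ IsLocalRing.maximalIdeal A) ∧
    RingTheory.Sequence.IsRegular A rs ∧ (rs.length : WithBot ℕ∞) = ringKrullDim A

/-- A ring is Cohen–Macaulay if it is Noetherian and all its localizations at prime ideals are
Cohen–Macaulay local rings. -/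
structure IsCohenMacaulayRing (A : Type*) [CommRing A] : Prop where
  noetherian : IsNoetherianRing A
  localization : ∀ (p : Ideal A) [p.IsPrime],
    IsCohenMacaulayLocalRing (Localization.AtPrime p)

/-- `J` is generically a complete intersection: for every associated prime `p` of `A ⧸ J`, the
ideal `J A_p` is generated by a regular sequence of `A_p`. -/
def IsGenericallyCompleteIntersection {A : Type*} [CommRing A] (J : Ideal A) : Prop :=
  ∀ (p : Ideal A) [p.IsPrime], p ∈ associatedPrimes A (A ⧸ J) →
    ∃ rs : List (Localization.AtPrime p),
      RingTheory.Sequence.IsRegular (Localization.AtPrime p) rs ∧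
      Ideal.ofList rs = J.map (algebraMap A (Localization.AtPrime p))

/-- A monomial ideal: an ideal generated by a set of monomials. -/
def IsMonomialIdeal {σ k : Type*} [CommRing k] (I : Ideal (MvPolynomial σ k)) : Prop :=
  ∃ S : Set (σ →₀ ℕ), I = Ideal.span ((fun e => MvPolynomial.monomial e (1 : k)) '' S)

/-- The exponents of the minimal monomial generators of a monomial ideal: those of the monomials in
the ideal that are minimal with respect to divisibility. -/
def minimalMonomialGenerators {σ k : Type*} [CommRing k] (I : Ideal (MvPolynomial σ k)) :
    Set (σ →₀ ℕ) :=
  {e | Minimal (fun e' => MvPolynomial.monomial e' (1 : k) ∈ I) e}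

/-- The signed maximal minor of an `(m + 1) × m` matrix obtained by deleting row `i`. -/
def signedMaximalMinor {A : Type*} [CommRing A] {m : ℕ} (φ : Matrix (Fin (m + 1)) (Fin m) A)
    (i : Fin (m + 1)) : A :=
  (-1) ^ (i : ℕ) * (φ.submatrix i.succAbove id).det

/-- The ideal of maximal minors of an `(m + 1) × m` matrix. -/
def maximalMinorsIdeal {A : Type*} [CommRing A] {m : ℕ} (φ : Matrix (Fin (m + 1)) (Fin m) A) :
    Ideal A :=
  Ideal.span (Set.range (signedMaximalMinor φ))

/-- `φ` is a Hilbert–Burch matrix of the ideal `K`: its signed maximal minors `f 0, …, f m` form a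
minimal generating set of `K`, and `0 → A^m → A^(m+1) → A → A ⧸ K → 0`, with the maps `φ` and
`(f 0, …, f m)`, is exact. -/
structure IsHilbertBurchMatrix {A : Type*} [CommRing A] {m : ℕ}
    (φ : Matrix (Fin (m + 1)) (Fin m) A) (K : Ideal A) : Prop where
  minors : maximalMinorsIdeal φ = K
  minimal : ∀ i, signedMaximalMinor φ i ∉ Ideal.span (signedMaximalMinor φ '' {j | j ≠ i})
  injective : Function.Injective φ.mulVec
  exact : ∀ v : Fin (m + 1) → A,
    ∑ i, v i * signedMaximalMinor φ i = 0 ↔ ∃ w : Fin m → A, φ.mulVec w = v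

/-- Every column has exactly two non-zero entries, and these are monomials up to a scalar. -/
def HasTwoMonomialColumns {ι κ σ k : Type*} [CommRing k]
    (φ : Matrix ι κ (MvPolynomial σ k)) : Prop :=
  ∀ j, {i | φ i j ≠ 0}.ncard = 2 ∧
    ∀ i, ∃ (e : σ →₀ ℕ) (c : k), φ i j = MvPolynomial.monomial e c

/-- `ψ` arises from the matrix `φ` with monomial entries by homogenizing the columns: zero entries
stay zero, and in each non-zero entry the exponents of the variables that occur in it are raised
(if necessary) until its degree is the largest degree of an entry of the same column of `φ`. -/
def IsColumnHomogenization {ι κ σ k : Type*} [Fintype ι] [CommRing k]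
    (φ ψ : Matrix ι κ (MvPolynomial σ k)) : Prop :=
  ∀ i j, (φ i j = 0 ∧ ψ i j = 0) ∨
    ∃ (e e' : σ →₀ ℕ) (c : k), c ≠ 0 ∧
      φ i j = MvPolynomial.monomial e c ∧ ψ i j = MvPolynomial.monomial e' c ∧
      e ≤ e' ∧ e'.support = e.support ∧
      e'.degree = Finset.univ.sup fun l => (φ l j).totalDegree

-- Localize at the origin. This gives a regular local ring of dimension `r`, over which the
-- Cohen–Macaulay quotient has depth at least `r - 2`. By the depth lemma the syzygy module of the
-- monomial generators has depth at least `r`, so a regular system of parameters is regular on it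
-- and it is free. Nakayama selects a basis among the Taylor syzygies, that is, a set of pairs of
-- generators, and a rank count leaves fewer pairs than generators. A Taylor syzygy is a combination
-- of selected ones only if its two generators are joined by a chain of selected pairs whose least
-- common multiples divide theirs (`exists_connecting_pairs_of_isCohenMacaulayRing`).
--
-- This combinatorial condition survives taking radicals of the generators, because radicals respect
-- divisibility and least common multiples, and it survives contracting superfluous generators.
-- Hence the minimal generators of the radical carry such a tree, with no separate proof that the
-- radical is Cohen–Macaulay. Stripping leaves orders them as `a 0, …, a m` so that each `a (j + 1)`
-- has an earlier parent dividing the least common multiple of `a (j + 1)` and any earlier `a i`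
-- (`exists_ordered_tree`). Equivalently, adjoining `a (j + 1)` has a principal colon ideal. This
-- single fact yields both the exactness of the Hilbert–Burch complex and the depth estimates.
--
-- Homogenization is analysed one variable at a time. For exponents zero or one the parent
-- inequality allows at most one edge along which the exponent drops from parent to child, and the
-- child is then the first generator without the variable (`IsExponentTree.drop`). So for any
-- positive replacement exponents, the minors `b i` keep their supports, the edge relations and the
-- parent inequality (`eq_zero_iff`, `add_eq`, `minor_le_max`). Thus `J` has the right radical and
-- is Cohen–Macaulay, and the equal degrees within each column make all minors have one degree.
-- Associated primes of `J` have height two, hence are generated by two variables `x`, `y`. The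
-- other variables are units there, and `exists_corners` shows that `J` becomes generated by a power
-- of `x` and a power of `y`.

universe u

/-! ### Depth through `Ext`, associated primes and regular sequences -/

section ExtDepth

open CategoryTheory Abelian IsLocalRing RingTheory.Sequence
open scoped Pointwise

/-- The depth of the module `M` over the local ring `A` is at least `n`, expressed through the
vanishing of `Ext` groups. -/
def DepthGE (A : Type u) [CommRing A] [IsLocalRing A] (M : Type u) [AddCommGroup M] [Module A M]
    (n : ℕ) : Prop :=
  ∀ i < n, Subsingleton (Ext (ModuleCat.of A (A ⧸ maximalIdeal A)) (ModuleCat.of A M) i)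

namespace DepthGE

variable {A : Type u} [CommRing A]
variable {K F M : Type u} [AddCommGroup K] [Module A K] [AddCommGroup F] [Module A F]
  [AddCommGroup M] [Module A M]

lemma shortExact {f : K →ₗ[A] F} {g : F →ₗ[A] M} (hf : Function.Injective f)
    (hfg : Function.Exact f g) (hg : Function.Surjective g) :
    (ModuleCat.shortComplexOfCompEqZero f g hfg.linearMap_comp_eq_zero).ShortExact where
  exact := ModuleCat.shortComplex_exact _ hfg
  mono_f := by simpa [ModuleCat.mono_iff_injective] using! hf
  epi_g := by simpa [ModuleCat.epi_iff_surjective] using! hg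

variable [IsLocalRing A]

lemma mono {m n : ℕ} (h : DepthGE A M n) (hmn : m ≤ n) : DepthGE A M m :=
  fun i hi => h i (hi.trans_le hmn)

lemma of_linearEquiv {n : ℕ} (e : K ≃ₗ[A] M) (h : DepthGE A K n) : DepthGE A M n := by
  intro i hi
  have h1 := AddCommGrpCat.isZero_of_iff_subsingleton.mpr (h i hi)
  have := (((extFunctorObj (ModuleCat.of A (A ⧸ maximalIdeal A)) i).mapIso e.toModuleIso).isZero_iff).mp h1
  exact AddCommGrpCat.subsingleton_of_isZero this

lemma of_subsingleton [Subsingleton M] (n : ℕ) : DepthGE A M n := by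
  intro i hi
  have h0 : Limits.IsZero (ModuleCat.of A M) := ModuleCat.isZero_of_subsingleton _
  refine ⟨fun a b => ?_⟩
  rw [← Ext.comp_mk₀_id a, ← Ext.comp_mk₀_id b, h0.eq_of_src (𝟙 _) 0]
  simp

/-- Long exact sequence of `Ext` out of the residue field; together with `of_exact_left` this is the
depth lemma. -/
lemma of_exact_right {n : ℕ} {f : K →ₗ[A] F} {g : F →ₗ[A] M} (hf : Function.Injective f)
    (hfg : Function.Exact f g) (hg : Function.Surjective g) (hK : DepthGE A K (n + 1))
    (hF : DepthGE A F n) : DepthGE A M n := by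
  intro i hi
  have z1 := AddCommGrpCat.isZero_of_iff_subsingleton.mpr (hF i hi)
  have z2 := AddCommGrpCat.isZero_of_iff_subsingleton.mpr (hK (i + 1) (by omega))
  exact AddCommGrpCat.subsingleton_of_isZero <| ShortComplex.Exact.isZero_of_both_zeros
    ((Ext.covariant_sequence_exact₃' _ (shortExact hf hfg hg)) i (i + 1) rfl)
    (z1.eq_zero_of_src _) (z2.eq_zero_of_tgt _)

lemma of_exact_left {n : ℕ} {f : K →ₗ[A] F} {g : F →ₗ[A] M} (hf : Function.Injective f)
    (hfg : Function.Exact f g) (hg : Function.Surjective g) (hF : DepthGE A F (n + 1))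
    (hM : DepthGE A M n) : DepthGE A K (n + 1) := by
  intro i hi
  cases i with
  | zero =>
    have hS := shortExact hf hfg hg
    have := hS.mono_f
    have z1 := hF 0 (by omega)
    have h2 : Subsingleton (ModuleCat.of A (A ⧸ maximalIdeal A) ⟶ ModuleCat.of A F) :=
      Ext.addEquiv₀.subsingleton_congr.mp z1
    refine Ext.addEquiv₀.subsingleton_congr.mpr ⟨fun a b => ?_⟩
    rw [← cancel_mono (ModuleCat.shortComplexOfCompEqZero f g hfg.linearMap_comp_eq_zero).f]
    exact h2.elim _ _
  | succ i =>
    have z1 := AddCommGrpCat.isZero_of_iff_subsingleton.mpr (hM i (by omega))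
    have z2 := AddCommGrpCat.isZero_of_iff_subsingleton.mpr (hF (i + 1) (by omega))
    exact AddCommGrpCat.subsingleton_of_isZero <| ShortComplex.Exact.isZero_of_both_zeros
      ((Ext.covariant_sequence_exact₁' _ (shortExact hf hfg hg)) i (i + 1) rfl)
      (z1.eq_zero_of_src _) (z2.eq_zero_of_tgt _)

lemma smul_top_lt [Module.Finite A M] [Nontrivial M] :
    maximalIdeal A • (⊤ : Submodule A M) < ⊤ :=
  (Submodule.top_ne_ideal_smul_of_le_jacobson_annihilator
    (maximalIdeal_le_jacobson _)).symm.lt_top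

lemma of_isWeaklyRegular [IsNoetherianRing A] [Module.Finite A M] {rs : List A}
    (hrs : ∀ x ∈ rs, x ∈ maximalIdeal A) (h : IsWeaklyRegular M rs) : DepthGE A M rs.length := by
  nontriviality M using of_subsingleton
  exact ModuleCat.subsingleton_ext_of_exists_isRegular (maximalIdeal A) _
    (by simp [Module.support_eq_zeroLocus, Ideal.annihilator_quotient]) (ModuleCat.of A M)
    smul_top_lt rs hrs (.of_isWeaklyRegular_of_mem_maximalIdeal _ hrs h)

lemma exists_isRegular [IsNoetherianRing A] [Module.Finite A M] [Nontrivial M] {n : ℕ}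
    (h : DepthGE A M n) :
    ∃ rs : List A, rs.length = n ∧ (∀ x ∈ rs, x ∈ maximalIdeal A) ∧ IsRegular M rs :=
  ModuleCat.exists_isRegular_of_exists_subsingleton_ext (maximalIdeal A) n (ModuleCat.of A M)
    smul_top_lt (ModuleCat.of A (A ⧸ maximalIdeal A))
    (by simp [Module.support_eq_zeroLocus, Ideal.annihilator_quotient]) h

lemma quotSMulTop {n : ℕ} {x : A} (hx : IsSMulRegular M x) (h : DepthGE A M (n + 1)) :
    DepthGE A (QuotSMulTop x M) n :=
  of_exact_right (f := LinearMap.lsmul A M x) hx (LinearMap.exact_lsmul_mkQ_smul_top M x)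
    (Submodule.mkQ_surjective _) h (h.mono n.le_succ)

lemma pi [IsNoetherianRing A] {n : ℕ} (ι : Type) [Finite ι] (h : DepthGE A A n) :
    DepthGE A (ι → A) n := by
  obtain ⟨rs, rfl, hm, hr⟩ := h.exists_isRegular
  have h2 : IsWeaklyRegular (TensorProduct A (ι → A) A) rs := hr.1.isWeaklyRegular_lTensor
  exact of_isWeaklyRegular hm (((TensorProduct.rid A (ι → A)).isWeaklyRegular_congr rs).mp h2)

end DepthGE

variable {A : Type u} [CommRing A] [IsLocalRing A] [IsNoetherianRing A]

/-- If `y` is regular on `M`, every associated prime of `M` is contained in an associated prime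
of `M / yM` that contains `y`. -/
lemma exists_isAssociatedPrime_quotSMulTop {M : Type u} [AddCommGroup M] [Module A M]
    [Module.Finite A M] {y : A} (hy : y ∈ maximalIdeal A) (hreg : IsSMulRegular M y) {p : Ideal A}
    (hp : IsAssociatedPrime p M) :
    ∃ q : Ideal A, IsAssociatedPrime q (QuotSMulTop y M) ∧ p ≤ q ∧ y ∈ q := by
  obtain ⟨hprime, x, hx⟩ := isAssociatedPrime_iff.mp hp
  have hmem : ∀ {a : A} {z : M}, a ∈ (⊥ : Submodule A M).colon {z} ↔ a • z = 0 := by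
    intro a z; simp [Submodule.mem_colon_singleton]
  let N : Submodule A M := Submodule.torsionBySet A M p
  -- `N` is the part of `M` killed by `p`. If it lay in `yM`, regularity of `y` would give `N = yN`,
  -- hence `N = 0` by Nakayama. An element of `N` outside `yM` has a non-zero class killed by `p`
  -- and `y`.
  have hN : ¬ N ≤ y • (⊤ : Submodule A M) := by
    intro hle
    have hNy : N ≤ Ideal.span {y} • N := by
      intro n hn
      obtain ⟨n', -, rfl⟩ := (Submodule.mem_smul_pointwise_iff_exists _ _ _).mp (hle hn)
      refine Submodule.smul_mem_smul (Ideal.mem_span_singleton_self y) ?_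
      rw [Submodule.mem_torsionBySet_iff] at hn ⊢
      intro a
      apply hreg
      have := hn a
      simp only [smul_zero]
      rw [← this, smul_comm]
    have hbot : N = ⊥ := Submodule.eq_bot_of_le_smul_of_le_jacobson_bot _ N
      (IsNoetherian.noetherian N) hNy (by
        rw [IsLocalRing.jacobson_eq_maximalIdeal _ bot_ne_top, Ideal.span_singleton_le_iff_mem]
        exact hy)
    have hxN : x ∈ N := by
      rw [Submodule.mem_torsionBySet_iff]
      rintro ⟨a, ha⟩
      exact hmem.mp (hx ▸ ha)
    rw [hbot, Submodule.mem_bot] at hxN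
    subst hxN
    apply hprime.ne_top
    rw [hx]
    simp
  obtain ⟨n, hnN, hn⟩ := Set.not_subset.mp hN
  have hne : (Submodule.Quotient.mk n : QuotSMulTop y M) ≠ 0 := by
    rwa [Ne, Submodule.Quotient.mk_eq_zero]
  obtain ⟨q, hq, hle⟩ := exists_le_isAssociatedPrime_of_isNoetherianRing A _ hne
  refine ⟨q, hq, fun a ha => hle ?_, hle ?_⟩
  · rw [Submodule.mem_colon_singleton, Submodule.mem_bot, ← Submodule.Quotient.mk_smul]
    have : a • n = 0 := (Submodule.mem_torsionBySet_iff _ _).mp hnN ⟨a, ha⟩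
    simp [this]
  · rw [Submodule.mem_colon_singleton, Submodule.mem_bot, ← Submodule.Quotient.mk_smul,
      Submodule.Quotient.mk_eq_zero]
    exact Submodule.smul_mem_pointwise_smul _ _ _ trivial

/-- The depth of a module is at most the dimension of each of its associated primes. -/
lemma DepthGE.le_ringKrullDim_quotient {n : ℕ} {M : Type u} [AddCommGroup M] [Module A M]
    [Module.Finite A M] (h : DepthGE A M n) {p : Ideal A} (hp : IsAssociatedPrime p M) :
    (n : WithBot ℕ∞) ≤ ringKrullDim (A ⧸ p) := by
  induction n generalizing M p with
  | zero =>
    have := Ideal.Quotient.nontrivial_iff.mpr hp.1.ne_top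
    exact ringKrullDim_nonneg_of_nontrivial
  | succ n ih =>
    have : Nontrivial M := by
      by_contra hM
      rw [not_nontrivial_iff_subsingleton] at hM
      exact not_isAssociatedPrime_of_subsingleton hp
    obtain ⟨rs, hl, hm, hr⟩ := h.exists_isRegular
    cases rs with
    | nil => simp at hl
    | cons y rs =>
      have hreg := ((isRegular_cons_iff M y rs).mp hr).1
      have hy := hm y (by simp)
      obtain ⟨q, hq, hpq, hyq⟩ := exists_isAssociatedPrime_quotSMulTop hy hreg hp
      have h1 := ih (h.quotSMulTop hreg) hq
      -- A regular element avoids `p`, so passing from `A ⧸ p` to `A ⧸ q` costs at least one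
      -- dimension, which pays for one unit of depth.
      have hyp : y ∉ p := by
        obtain ⟨hprime, x, hx⟩ := isAssociatedPrime_iff.mp hp
        intro hyp
        rw [hx, Submodule.mem_colon_singleton, Submodule.mem_bot] at hyp
        have hx0 : x = 0 := hreg (by simpa using hyp)
        subst hx0
        exact hprime.ne_top (by rw [hx]; simp)
      have := hp.1
      have h2 := ringKrullDim_succ_le_of_surjective (Ideal.Quotient.factor hpq)
        (Ideal.Quotient.factor_surjective hpq) (r := Ideal.Quotient.mk p y)
        (mem_nonZeroDivisors_of_ne_zero (by rwa [Ne, Ideal.Quotient.eq_zero_iff_mem]))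
        (by simpa [Ideal.Quotient.eq_zero_iff_mem] using hyq)
      calc ((n + 1 : ℕ) : WithBot ℕ∞) = (n : WithBot ℕ∞) + 1 := by push_cast; rfl
        _ ≤ ringKrullDim (A ⧸ q) + 1 := by gcongr
        _ ≤ _ := h2

/-- Modulo `p` the sequence generates the maximal ideal, and the number of its generators bounds the
dimension. -/
lemma ringKrullDim_quotient_le_length {p : Ideal A} [p.IsPrime] {rs : List A}
    (hm : ∀ x ∈ rs, x ∈ maximalIdeal A) (h : maximalIdeal A ≤ p ⊔ Ideal.ofList rs) :
    ringKrullDim (A ⧸ p) ≤ rs.length := by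
  classical
  have : IsLocalRing (A ⧸ p) := .of_surjective' _ Ideal.Quotient.mk_surjective
  have hmap := IsLocalRing.map_maximalIdeal_of_surjective _
    (Ideal.Quotient.mk_surjective (I := p))
  have hspan : maximalIdeal (A ⧸ p) =
      Ideal.span ((rs.map (Ideal.Quotient.mk p)).toFinset : Set (A ⧸ p)) := by
    have : Ideal.span ((rs.map (Ideal.Quotient.mk p)).toFinset : Set (A ⧸ p)) =
        (Ideal.ofList rs).map (Ideal.Quotient.mk p) := by
      rw [Ideal.map_ofList]
      congr 1
      ext x
      simp
    rw [this, ← hmap]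
    refine le_antisymm ((Ideal.map_mono h).trans ?_) (Ideal.map_mono (Ideal.span_le.mpr hm))
    rw [Ideal.map_sup, Ideal.map_quotient_self, bot_sup_eq]
  refine (ringKrullDim_le_spanFinrank_maximalIdeal _).trans ?_
  rw [hspan]
  have h1 := Submodule.spanFinrank_span_le_ncard_of_finite (R := A ⧸ p)
    (s := ((rs.map (Ideal.Quotient.mk p)).toFinset : Set (A ⧸ p))) (Finset.finite_toSet _)
  rw [Set.ncard_coe_finset] at h1
  have h2 := h1.trans (List.toFinset_card_le _)
  rw [List.length_map] at h2
  exact_mod_cast h2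

/-- A module of depth `rs.length` is regular along `rs` if, modulo its annihilator, `rs` generates
the maximal ideal. -/
lemma DepthGE.isWeaklyRegular {rs : List A} {M : Type u} [AddCommGroup M] [Module A M]
    [Module.Finite A M] (hm : ∀ x ∈ rs, x ∈ maximalIdeal A)
    (hrs : maximalIdeal A ≤ Module.annihilator A M ⊔ Ideal.ofList rs)
    (h : DepthGE A M rs.length) : IsWeaklyRegular M rs := by
  induction rs generalizing M with
  | nil => exact IsWeaklyRegular.nil A M
  | cons x rs ih =>
    -- A zero divisor `x` lies in an associated prime `p`, which contains the annihilator. The tail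
    -- `rs` then generates the maximal ideal of `A ⧸ p`, whose dimension would be smaller than the
    -- depth.
    have hreg : IsSMulRegular M x := by
      by_contra hx
      have hx' : x ∈ { r : A | IsSMulRegular M r }ᶜ := hx
      rw [← biUnion_associatedPrimes_eq_compl_regular] at hx'
      simp only [Set.mem_iUnion] at hx'
      obtain ⟨p, hp, hxp⟩ := hx'
      have := hp.1
      have h1 := h.le_ringKrullDim_quotient hp
      have h2 : ringKrullDim (A ⧸ p) ≤ rs.length := by
        apply ringKrullDim_quotient_le_length (fun y hy => hm y (by simp [hy]))
        refine hrs.trans (sup_le ?_ ?_)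
        · refine le_trans ?_ le_sup_left
          have := IsAssociatedPrime.annihilator_le hp
          rwa [Submodule.annihilator_top] at this
        · rw [Ideal.ofList_cons]
          exact sup_le_sup_right ((Ideal.span_singleton_le_iff_mem p).mpr hxp) _
      have h3 := h1.trans h2
      have h4 : (x :: rs).length ≤ rs.length := by exact_mod_cast h3
      simp at h4
    refine IsWeaklyRegular.cons hreg (ih (fun y hy => hm y (by simp [hy])) ?_ (h.quotSMulTop hreg))
    refine hrs.trans (sup_le (le_sup_of_le_left ?_) ?_)
    · exact LinearMap.annihilator_le_of_surjective _ (Submodule.mkQ_surjective _)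
    · rw [Ideal.ofList_cons]
      refine sup_le (le_sup_of_le_left ?_) le_sup_right
      rw [Ideal.span_singleton_le_iff_mem, Module.mem_annihilator]
      intro z
      obtain ⟨z, rfl⟩ := Submodule.mkQ_surjective _ z
      rw [← map_smul, Submodule.mkQ_apply, Submodule.Quotient.mk_eq_zero]
      exact Submodule.smul_mem_pointwise_smul _ _ _ trivial

end ExtDepth

/-! ### Regular local rings have full depth -/

section RegularLocal

open IsLocalRing RingTheory.Sequence
open scoped Pointwise

/-- A Noetherian local ring whose maximal ideal is generated by `dim A` elements is a domain. -/
lemma isDomain_of_span_eq_maximalIdeal (n : ℕ) {A : Type u} [CommRing A] [IsLocalRing A]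
    [IsNoetherianRing A] (y : Fin n → A) (hy : Ideal.span (Set.range y) = maximalIdeal A)
    (hn : (n : WithBot ℕ∞) ≤ ringKrullDim A) : IsDomain A := by
  induction n generalizing A with
  | zero =>
    have : maximalIdeal A = ⊥ := by rw [← hy]; simp
    exact (isField_iff_maximalIdeal_eq.mpr this).isDomain
  | succ n ih =>
    have hmin : ∀ p ∈ minimalPrimes A, ¬ maximalIdeal A ≤ p := by
      intro p hp hle
      have hpm : maximalIdeal A = p := le_antisymm hle (le_maximalIdeal hp.1.1.ne_top)
      have h0 : (maximalIdeal A).height = 0 := by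
        rw [Ideal.height_eq_zero_iff, hpm]; exact hp
      rw [← IsLocalRing.maximalIdeal_height_eq_ringKrullDim, h0] at hn
      have : n + 1 ≤ 0 := by exact_mod_cast hn
      omega
    have hfin : (minimalPrimes A).Finite := minimalPrimes.finite_of_isNoetherianRing A
    have hsq : ¬ maximalIdeal A ≤ maximalIdeal A ^ 2 := by
      intro hle
      have hbot : maximalIdeal A = ⊥ := Submodule.eq_bot_of_le_smul_of_le_jacobson_bot
        (maximalIdeal A) (maximalIdeal A) (IsNoetherian.noetherian _)
        (by rw [smul_eq_mul, ← sq]; exact hle)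
        (by rw [IsLocalRing.jacobson_eq_maximalIdeal _ bot_ne_top])
      have : IsDomain A := (isField_iff_maximalIdeal_eq.mpr hbot).isDomain
      refine hmin ⊥ ?_ hbot.le
      simp [IsDomain.minimalPrimes_eq_singleton_bot]
    -- Prime avoidance tolerates the one non-prime ideal. Being outside the square lets `x` replace
    -- a generator; being outside the minimal primes forces a minimal prime `q ⊆ (x)` to satisfy `q
    -- = xq`, hence `q = 0`.
    obtain ⟨x, hxm, hx2, hxmin⟩ : ∃ x ∈ maximalIdeal A, x ∉ maximalIdeal A ^ 2 ∧
        ∀ p ∈ minimalPrimes A, x ∉ p := by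
      have := mt (Ideal.subset_union_prime_finite (s := insert (maximalIdeal A ^ 2) (minimalPrimes A))
        (f := id) (hfin.insert _) (maximalIdeal A ^ 2) (maximalIdeal A ^ 2) (by
          intro i hi h1 _
          exact (hi.resolve_left h1).1.1) (I := maximalIdeal A)).mp (by
            rintro ⟨p, hp | hp, hle⟩
            · subst hp; exact hsq hle
            · exact hmin p hp hle)
      obtain ⟨x, hx, hx'⟩ := Set.not_subset.mp this
      simp only [Set.mem_iUnion, not_exists] at hx'
      exact ⟨x, hx, hx' _ (Set.mem_insert _ _), fun p hp => hx' p (Set.mem_insert_of_mem _ hp)⟩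
    -- exchange `x` for one of the generators
    have hxs := hxm
    rw [← hy] at hxs
    obtain ⟨c, hc⟩ := (Ideal.mem_span_range_iff_exists_fun).mp hxs
    obtain ⟨i, hi⟩ : ∃ i, IsUnit (c i) := by
      by_contra! hcon
      apply hx2
      rw [← hc, sq]
      refine Ideal.sum_mem _ fun i _ => Ideal.mul_mem_mul ((mem_maximalIdeal _).mpr (hcon i)) ?_
      rw [← hy]; exact Ideal.subset_span ⟨i, rfl⟩
    have hyi : y i ∈ Ideal.span {x} ⊔ Ideal.span (Set.range (y ∘ i.succAbove)) := by
      have : c i * y i ∈ Ideal.span {x} ⊔ Ideal.span (Set.range (y ∘ i.succAbove)) := by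
        have h1 : c i * y i = x - ∑ j, c (i.succAbove j) * y (i.succAbove j) := by
          rw [← hc, Fin.sum_univ_succAbove _ i]; ring
        rw [h1]
        refine Ideal.sub_mem _ (Ideal.mem_sup_left (Ideal.mem_span_singleton_self x))
          (Ideal.mem_sup_right (Ideal.sum_mem _ fun j _ => Ideal.mul_mem_left _ _
            (Ideal.subset_span ⟨j, rfl⟩)))
      exact (Ideal.unit_mul_mem_iff_mem _ hi).mp this
    have hmax : maximalIdeal A = Ideal.span {x} ⊔ Ideal.span (Set.range (y ∘ i.succAbove)) := by
      refine le_antisymm ?_ (sup_le ((Ideal.span_singleton_le_iff_mem _).mpr hxm) ?_)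
      · rw [← hy, Ideal.span_le]
        rintro _ ⟨j, rfl⟩
        rcases Fin.eq_self_or_eq_succAbove i j with rfl | ⟨k, rfl⟩
        · exact hyi
        · exact Ideal.mem_sup_right (Ideal.subset_span ⟨k, rfl⟩)
      · rw [← hy]
        exact Ideal.span_mono (by rintro _ ⟨j, rfl⟩; exact ⟨_, rfl⟩)
    have : Nontrivial (A ⧸ Ideal.span {x}) := Ideal.Quotient.nontrivial_iff.mpr
      (ne_top_of_le_ne_top (Ideal.IsPrime.ne_top inferInstance : maximalIdeal A ≠ ⊤)
        ((Ideal.span_singleton_le_iff_mem _).mpr hxm))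
    have : IsLocalRing (A ⧸ Ideal.span {x}) := .of_surjective' _ Ideal.Quotient.mk_surjective
    have hdom : IsDomain (A ⧸ Ideal.span {x}) := by
      refine ih (Ideal.Quotient.mk (Ideal.span {x}) ∘ y ∘ i.succAbove) ?_ ?_
      · rw [← IsLocalRing.map_maximalIdeal_of_surjective _ Ideal.Quotient.mk_surjective, hmax,
          Ideal.map_sup, Ideal.map_quotient_self, bot_sup_eq, Ideal.map_span, Set.range_comp]
      · have h1 := ringKrullDim_le_ringKrullDim_quotient_add_encard {x} (R := A)
          (by rw [IsLocalRing.ringJacobson_eq_maximalIdeal]; simpa using hxm)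
        have h2 := hn.trans h1
        simp only [Set.encard_singleton] at h2
        push_cast at h2
        exact ENat.WithBot.add_le_add_one_right_iff.mp h2
    have hxp : (Ideal.span {x}).IsPrime := (Ideal.Quotient.isDomain_iff_prime _).mp hdom
    obtain ⟨q, hq, hqx⟩ := Ideal.exists_minimalPrimes_le (bot_le (a := Ideal.span {x}))
    have hxq := hxmin q hq
    have hqbot : q = ⊥ := by
      refine Submodule.eq_bot_of_le_smul_of_le_jacobson_bot (Ideal.span {x}) q
        (IsNoetherian.noetherian _) ?_ (by
          rw [IsLocalRing.jacobson_eq_maximalIdeal _ bot_ne_top]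
          exact (Ideal.span_singleton_le_iff_mem _).mpr hxm)
      intro z hz
      obtain ⟨w, rfl⟩ := Ideal.mem_span_singleton'.mp (hqx hz)
      have hw : w ∈ q := (hq.1.1.mem_or_mem hz).resolve_right hxq
      rw [mul_comm]
      exact Submodule.smul_mem_smul (Ideal.mem_span_singleton_self x) hw
    have := hq.1.1
    rw [hqbot] at this
    exact IsDomain.of_bot_isPrime A


/-- The ring is a domain and the first element is non-zero, as otherwise the tail would generate the
maximal ideal with too few elements. The quotient satisfies the same hypotheses. -/
lemma isWeaklyRegular_of_ofList_eq_maximalIdeal {A : Type u} [CommRing A] [IsLocalRing A]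
    [IsNoetherianRing A] {rs : List A} (hrs : Ideal.ofList rs = maximalIdeal A)
    (hn : (rs.length : WithBot ℕ∞) ≤ ringKrullDim A) : IsWeaklyRegular A rs := by
  obtain ⟨n, hlen⟩ : ∃ n, rs.length = n := ⟨_, rfl⟩
  induction n generalizing A with
  | zero =>
    rw [List.length_eq_zero_iff] at hlen
    subst hlen
    exact IsWeaklyRegular.nil A A
  | succ n ih =>
    obtain ⟨x, rs, rfl⟩ := List.exists_cons_of_length_eq_add_one hlen
    have hdom : IsDomain A := by
      refine isDomain_of_span_eq_maximalIdeal (x :: rs).length (x :: rs).get ?_ hn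
      rw [← hrs, Ideal.ofList]
      congr 1
      ext a
      simp [List.mem_iff_get]
    have hxm : x ∈ maximalIdeal A := by
      rw [← hrs]; exact Ideal.subset_span (by simp)
    have hx0 : x ≠ 0 := by
      rintro rfl
      have : ringKrullDim A ≤ rs.length := by
        have h1 := ringKrullDim_quotient_le_length (A := A) (p := ⊥) (rs := rs) (fun y hy => by
          rw [← hrs]; exact Ideal.subset_span (by simp [hy])) (by
            rw [← hrs, Ideal.ofList_cons]; simp)
        rwa [ringKrullDim_eq_of_ringEquiv (RingEquiv.quotientBot A)] at h1
      have h2 := hn.trans this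
      have h3 : (0 :: rs : List A).length ≤ rs.length := by exact_mod_cast h2
      simp at h3
    have : Nontrivial (A ⧸ Ideal.span {x}) := Ideal.Quotient.nontrivial_iff.mpr
      (ne_top_of_le_ne_top (Ideal.IsPrime.ne_top inferInstance : maximalIdeal A ≠ ⊤)
        ((Ideal.span_singleton_le_iff_mem _).mpr hxm))
    have : IsLocalRing (A ⧸ Ideal.span {x}) := .of_surjective' _ Ideal.Quotient.mk_surjective
    have h1 : IsWeaklyRegular (A ⧸ Ideal.span {x}) (rs.map (algebraMap A (A ⧸ Ideal.span {x}))) := by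
      refine ih ?_ ?_ (by simpa using hlen)
      · rw [← Ideal.map_ofList, Ideal.Quotient.algebraMap_eq,
          ← IsLocalRing.map_maximalIdeal_of_surjective _ Ideal.Quotient.mk_surjective, ← hrs,
          Ideal.ofList_cons, Ideal.map_sup, Ideal.map_quotient_self, bot_sup_eq]
      · have h1 := ringKrullDim_le_ringKrullDim_quotient_add_encard {x} (R := A)
          (by rw [IsLocalRing.ringJacobson_eq_maximalIdeal]; simpa using hxm)
        have h2 := hn.trans h1
        simp only [Set.encard_singleton, List.length_cons] at h2
        push_cast at h2
        rw [List.length_map]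
        exact ENat.WithBot.add_le_add_one_right_iff.mp h2
    rw [isWeaklyRegular_map_algebraMap_iff] at h1
    refine IsWeaklyRegular.cons (IsSMulRegular.of_ne_zero hx0) ?_
    refine (LinearEquiv.isWeaklyRegular_congr (Submodule.quotEquivOfEq _ _ ?_) rs).mp h1
    rw [← Submodule.ideal_span_singleton_smul]
    simp

lemma depthGE_of_isRegularLocalRing (A : Type u) [CommRing A]
    [hA : IsRegularLocalRing A] {n : ℕ} (hn : n ≤ ringKrullDim A) : DepthGE A A n := by
  have h := hA.spanFinrank_maximalIdeal
  have hfg : (maximalIdeal A).FG := IsNoetherian.noetherian _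
  have hfin := Submodule.FG.finite_generators hfg
  have hcard := Submodule.FG.generators_ncard hfg
  set rs := hfin.toFinset.toList with hrs
  have hlen : rs.length = (maximalIdeal A).spanFinrank := by
    rw [hrs, Finset.length_toList, ← hcard, Set.ncard_eq_toFinset_card _ hfin]
  have hspan : Ideal.ofList rs = maximalIdeal A := by
    conv_rhs => rw [← (maximalIdeal A).span_generators]
    rw [Ideal.ofList, Ideal.span]
    congr 1
    ext x
    simp [hrs]
  have h2 : n ≤ rs.length := by
    rw [← h, ← hlen] at hn
    exact_mod_cast hn
  refine (DepthGE.of_isWeaklyRegular (fun x hx => ?_)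
    (isWeaklyRegular_of_ofList_eq_maximalIdeal hspan (by rw [hlen, h]))).mono h2
  rw [← hspan]; exact Ideal.subset_span hx

end RegularLocal

/-! ### Passing between a ring and its quotients: depth, localization, height -/

section QuotientLocalization

open IsLocalRing RingTheory.Sequence

/-- Regularity on `B` is the same over `A` as over `B`, so depth may be computed over the regular
ring `A`; the next lemma is the converse. -/
lemma DepthGE.of_isCohenMacaulayLocalRing {A B : Type u} [CommRing A] [IsLocalRing A]
    [IsNoetherianRing A] [CommRing B] [IsLocalRing B] [Algebra A B]
    (hsurj : Function.Surjective (algebraMap A B)) (hB : IsCohenMacaulayLocalRing B) {n : ℕ}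
    (hn : n ≤ ringKrullDim B) : DepthGE A B n := by
  obtain ⟨rs, hm, hr, hl⟩ := hB.exists_isRegular
  have : Module.Finite A B := Module.Finite.of_surjective (Algebra.linearMap A B) hsurj
  obtain ⟨rs', rfl⟩ := List.map_surjective_iff.mpr hsurj rs
  have h1 := (isWeaklyRegular_map_algebraMap_iff _ _ _).mp hr.1
  rw [← hl, List.length_map] at hn
  refine (DepthGE.of_isWeaklyRegular (fun x hx => ?_) h1).mono (by exact_mod_cast hn)
  have := hm (algebraMap A B x) (List.mem_map_of_mem hx)
  rw [mem_maximalIdeal] at this ⊢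
  exact fun h => this (h.map _)

lemma DepthGE.isCohenMacaulayLocalRing {A B : Type u} [CommRing A] [IsLocalRing A]
    [IsNoetherianRing A] [CommRing B] [IsLocalRing B] [Algebra A B]
    (hsurj : Function.Surjective (algebraMap A B)) {n : ℕ} (h : DepthGE A B n)
    (hn : ringKrullDim B ≤ n) : IsCohenMacaulayLocalRing B := by
  have : Module.Finite A B := Module.Finite.of_surjective (Algebra.linearMap A B) hsurj
  have hB : IsNoetherianRing B := isNoetherianRing_of_surjective A B _ hsurj
  obtain ⟨rs, hl, hm, hr⟩ := h.exists_isRegular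
  have hloc : IsLocalHom (algebraMap A B) := IsLocalHom.of_surjective _ hsurj
  have hm' : ∀ x ∈ rs.map (algebraMap A B), x ∈ maximalIdeal B := by
    intro x hx
    obtain ⟨y, hy, rfl⟩ := List.mem_map.mp hx
    have := hm y hy
    rw [mem_maximalIdeal] at this ⊢
    exact fun h => this (isUnit_of_map_unit _ _ h)
  have hr' : IsRegular B (rs.map (algebraMap A B)) := .of_isWeaklyRegular_of_mem_maximalIdeal _ hm'
    ((isWeaklyRegular_map_algebraMap_iff _ _ _).mpr hr.1)
  refine ⟨hB, _, hm', hr', le_antisymm ?_ ?_⟩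
  · rw [← ringKrullDim_add_length_eq_ringKrullDim_of_isRegular _ hr']
    have hne : Ideal.ofList (rs.map (algebraMap A B)) ≠ ⊤ :=
      ne_top_of_le_ne_top (Ideal.IsPrime.ne_top inferInstance : maximalIdeal B ≠ ⊤)
        (Ideal.span_le.mpr hm')
    have := Ideal.Quotient.nontrivial_iff.mpr hne
    exact le_add_of_nonneg_left ringKrullDim_nonneg_of_nontrivial
  · rw [List.length_map, hl]; exact hn

lemma Ideal.ker_localRingHom_mk {R : Type u} [CommRing R] (I : Ideal R) (p : Ideal (R ⧸ I))
    [p.IsPrime] :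
    RingHom.ker (Localization.localRingHom (p.comap (Ideal.Quotient.mk I)) p
      (Ideal.Quotient.mk I) rfl) =
      I.map (algebraMap R (Localization.AtPrime (p.comap (Ideal.Quotient.mk I)))) := by
  set P := p.comap (Ideal.Quotient.mk I)
  refine le_antisymm ?_ ?_
  · intro z hz
    obtain ⟨⟨r, s⟩, rfl⟩ := IsLocalization.mk'_surjective P.primeCompl z
    simp only [RingHom.mem_ker, Localization.localRingHom_mk'] at hz
    rw [IsLocalization.mk'_eq_zero_iff] at hz
    obtain ⟨⟨t, ht⟩, htr⟩ := hz
    obtain ⟨t, rfl⟩ := Ideal.Quotient.mk_surjective t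
    simp only [← map_mul, Ideal.Quotient.eq_zero_iff_mem] at htr
    rw [IsLocalization.mk'_mem_map_algebraMap_iff P.primeCompl]
    exact ⟨t, ht, htr⟩
  · rw [Ideal.map_le_iff_le_comap]
    intro x hx
    simp [RingHom.mem_ker, Localization.localRingHom_to_map, Ideal.Quotient.eq_zero_iff_mem.mpr hx]

/-- A chain of primes below `p` lifts to primes containing `J`, and the lowest of these already has
height at least that of `J`. -/
lemma Ideal.height_add_height_le_height_comap_mk {R : Type u} [CommRing R] (J : Ideal R) (n : ℕ)
    (p : Ideal (R ⧸ J)) [p.IsPrime] (hn : n ≤ p.height) :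
    n + J.height ≤ (p.comap (Ideal.Quotient.mk J)).height := by
  induction n generalizing p with
  | zero =>
    simp only [Nat.cast_zero, zero_add]
    apply Ideal.height_mono
    intro x hx
    simp [Ideal.mem_comap, Ideal.Quotient.eq_zero_iff_mem.mpr hx]
  | succ n ih =>
    obtain ⟨q, hq, hqp, hnq⟩ : ∃ q : Ideal (R ⧸ J), q.IsPrime ∧ q < p ∧ n ≤ q.height := by
      by_contra! hcon
      have := (Ideal.height_le_iff (p := p) (n := n)).mpr hcon
      have := hn.trans this
      have : n + 1 ≤ n := by exact_mod_cast this
      omega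
    have h1 := ih q hnq
    have hlt : q.comap (Ideal.Quotient.mk J) < p.comap (Ideal.Quotient.mk J) :=
      (Ideal.orderEmbeddingOfSurjective _ Ideal.Quotient.mk_surjective).strictMono hqp
    have h2 := Ideal.height_add_one_le_of_lt_of_isPrime hlt
    calc ((n + 1 : ℕ) : ℕ∞) + J.height = n + J.height + 1 := by push_cast; ring
      _ ≤ (q.comap (Ideal.Quotient.mk J)).height + 1 := by gcongr
      _ ≤ _ := h2

end QuotientLocalization

/-! ### Freeness of modules of maximal depth -/

section Freeness

open IsLocalRing RingTheory.Sequence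
open scoped Pointwise

/-- If `rs` is regular on the quotient `Z` of `F` by `K`, then `K ∩ (rs)F ⊆ (rs)K`. -/
lemma RingTheory.Sequence.IsWeaklyRegular.ker_inf_smul_top_le {A F Z : Type*} [CommRing A]
    [AddCommGroup F] [Module A F] [AddCommGroup Z] [Module A Z] {rs : List A}
    (h : IsWeaklyRegular Z rs) (f : F →ₗ[A] Z) (hf : Function.Surjective f) :
    LinearMap.ker f ⊓ Ideal.ofList rs • (⊤ : Submodule A F) ≤ Ideal.ofList rs • LinearMap.ker f := by
  induction rs generalizing Z with
  | nil => simp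
  | cons x rs ih =>
    obtain ⟨hx, hrs⟩ := (isWeaklyRegular_cons_iff Z x rs).mp h
    -- Vanishing of Tor by hand: the kernel of `F → Z ⧸ xZ` is `ker f + xF`; induction treats this
    -- quotient, and the remaining multiple of `x` is divided by `x` using regularity on `Z`.
    have hq : Function.Surjective ((x • (⊤ : Submodule A Z)).mkQ ∘ₗ f) :=
      (Submodule.mkQ_surjective _).comp hf
    have hker : LinearMap.ker ((x • (⊤ : Submodule A Z)).mkQ ∘ₗ f) ≤
        LinearMap.ker f ⊔ x • (⊤ : Submodule A F) := by
      intro v hv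
      simp only [LinearMap.mem_ker, LinearMap.comp_apply, Submodule.mkQ_apply,
        Submodule.Quotient.mk_eq_zero] at hv
      obtain ⟨z, -, hz⟩ := (Submodule.mem_smul_pointwise_iff_exists _ _ _).mp hv
      obtain ⟨w, rfl⟩ := hf z
      have : v = (v - x • w) + x • w := by abel
      rw [this]
      refine Submodule.add_mem_sup ?_ (Submodule.smul_mem_pointwise_smul _ _ _ trivial)
      simp [hz]
    have ih' := ih hrs _ hq
    rw [Ideal.ofList_cons_smul, Ideal.ofList_cons_smul]
    rintro k ⟨hk, hk'⟩
    obtain ⟨y, hy, g, hg, rfl⟩ := Submodule.mem_sup.mp hk'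
    obtain ⟨w, -, rfl⟩ := (Submodule.mem_smul_pointwise_iff_exists _ _ _).mp hy
    have hg' : g ∈ Ideal.ofList rs • (LinearMap.ker f ⊔ x • (⊤ : Submodule A F)) := by
      refine Submodule.smul_mono le_rfl hker (ih' ⟨?_, hg⟩)
      have h0 : f (x • w + g) = 0 := hk
      have h1 : f g = x • f (-w) := by
        rw [map_add, map_smul] at h0
        rw [map_neg, smul_neg]
        exact eq_neg_of_add_eq_zero_right h0
      rw [SetLike.mem_coe, LinearMap.mem_ker, LinearMap.comp_apply, h1, Submodule.mkQ_apply,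
        Submodule.Quotient.mk_eq_zero]
      exact Submodule.smul_mem_pointwise_smul _ _ _ trivial
    rw [Submodule.smul_sup] at hg'
    obtain ⟨κ, hκ, t, ht, rfl⟩ := Submodule.mem_sup.mp hg'
    have ht' : t ∈ x • (⊤ : Submodule A F) := Submodule.smul_le_right ht
    obtain ⟨w', -, rfl⟩ := (Submodule.mem_smul_pointwise_iff_exists _ _ _).mp ht'
    have hκ' : κ ∈ LinearMap.ker f := Submodule.smul_le_right hκ
    have hw : w + w' ∈ LinearMap.ker f := by
      have h0 : f (x • w + (κ + x • w')) = 0 := hk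
      have h1 : x • f (w + w') = x • (0 : Z) := by
        have h2 : f κ = 0 := hκ'
        rw [map_add, map_add, h2, zero_add, ← map_add, ← smul_add, map_smul] at h0
        rw [h0, smul_zero]
      exact hx h1
    have : x • w + (κ + x • w') = x • (w + w') + κ := by rw [smul_add]; abel
    rw [this]
    exact Submodule.add_mem_sup (Submodule.smul_mem_pointwise_smul _ _ _ hw) hκ

/-- Over a local ring whose maximal ideal is generated by a sequence that is regular on `Z`, every
finite generating family of `Z` contains a basis. -/
lemma exists_finset_linearIndependent_span_eq_top {A Z ι : Type*} [CommRing A] [IsLocalRing A]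
    [IsNoetherianRing A] [AddCommGroup Z] [Module A Z] [Finite ι] {rs : List A}
    (h : IsWeaklyRegular Z rs) (hrs : Ideal.ofList rs = maximalIdeal A) (v : ι → Z)
    (hv : Submodule.span A (Set.range v) = ⊤) :
    ∃ s : Finset ι, LinearIndependent A (fun i : s => v i) ∧
      Submodule.span A (v '' s) = ⊤ := by
  classical
  have := Fintype.ofFinite ι
  have hex : ∃ n, ∃ s : Finset ι, s.card = n ∧ Submodule.span A (v '' s) = ⊤ :=
    ⟨_, Finset.univ, rfl, by simpa using hv⟩
  -- A generating subfamily of least size. A unit coefficient in a relation would make a generator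
  -- redundant, so all relations lie in `m F`; by the preceding lemma they lie in `m` times
  -- themselves, and Nakayama applies.
  obtain ⟨s, hs, hspan⟩ := Nat.find_spec hex
  refine ⟨s, ?_, hspan⟩
  have hmin : ∀ t : Finset ι, Submodule.span A (v '' t) = ⊤ → s.card ≤ t.card := fun t ht => by
    rw [hs]; exact Nat.find_min' hex ⟨t, rfl, ht⟩
  let f : (s → A) →ₗ[A] Z := Fintype.linearCombination A (fun i : s => v i)
  have hf : Function.Surjective f := by
    rw [← LinearMap.range_eq_top, Fintype.range_linearCombination, ← hspan]
    congr 1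
    ext z
    simp
  have hK : LinearMap.ker f ≤ maximalIdeal A • (⊤ : Submodule A (s → A)) := by
    intro c hc
    have hc0 : ∑ i : s, c i • v i = 0 := by
      simpa [f, Fintype.linearCombination_apply] using hc
    have hci : ∀ i, c i ∈ maximalIdeal A := by
      by_contra! hcon
      obtain ⟨i, hi⟩ := hcon
      rw [mem_maximalIdeal, mem_nonunits_iff, not_not] at hi
      have hvi : v i ∈ Submodule.span A (v '' (s.erase i : Finset ι)) := by
        have h1 : c i • v i ∈ Submodule.span A (v '' (s.erase i : Finset ι)) := by
          rw [← Finset.add_sum_erase _ _ (Finset.mem_univ i)] at hc0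
          rw [eq_neg_of_add_eq_zero_left hc0]
          refine Submodule.neg_mem _ (Submodule.sum_mem _ fun j hj => Submodule.smul_mem _ _
            (Submodule.subset_span ⟨j, ?_, rfl⟩))
          rw [Finset.mem_erase] at hj
          simpa using fun h => hj.1 (Subtype.ext h)
        obtain ⟨a, ha⟩ := hi.exists_left_inv
        have := Submodule.smul_mem _ a h1
        rwa [smul_smul, ha, one_smul] at this
      have := hmin (s.erase i) (by
        rw [eq_top_iff, ← hspan, Submodule.span_le]
        rintro _ ⟨j, hj, rfl⟩
        by_cases hji : j = i
        · rw [hji]; exact hvi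
        · exact Submodule.subset_span ⟨j, by simpa [hji] using hj, rfl⟩)
      have h2 := Finset.card_erase_lt_of_mem i.2
      omega
    have : c = ∑ i, c i • Pi.single i (1 : A) := by
      ext j
      simp [Finset.sum_apply, Pi.single_apply]
    rw [this]
    exact Submodule.sum_mem _ fun i _ => Submodule.smul_mem_smul (hci i) trivial
  have hK2 : LinearMap.ker f ≤ maximalIdeal A • LinearMap.ker f := by
    have := h.ker_inf_smul_top_le f hf
    rw [hrs] at this
    exact (le_inf le_rfl hK).trans this
  have hbot : LinearMap.ker f = ⊥ := Submodule.eq_bot_of_le_smul_of_le_jacobson_bot _ _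
    (IsNoetherian.noetherian _) hK2 (by rw [IsLocalRing.jacobson_eq_maximalIdeal _ bot_ne_top])
  rw [Fintype.linearIndependent_iff]
  intro c hc i
  have : c ∈ LinearMap.ker f := by simpa [f, Fintype.linearCombination_apply] using hc
  rw [hbot, Submodule.mem_bot] at this
  simp [this]

/-- Linearly independent vectors in the kernel of a non-zero functional on `A ^ ι` are fewer than
the dimension. -/
lemma LinearIndependent.card_add_one_le_of_mem_ker {A ι κ : Type*} [CommRing A] [IsDomain A]
    [Fintype ι] [Fintype κ] {g : (ι → A) →ₗ[A] A} (hg : g ≠ 0) {v : κ → ι → A}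
    (hv : LinearIndependent A v) (hgv : ∀ i, g (v i) = 0) :
    Fintype.card κ + 1 ≤ Fintype.card ι := by
  obtain ⟨w, hw⟩ : ∃ w, g w ≠ 0 := by
    by_contra! hcon
    exact hg (LinearMap.ext hcon)
  -- A vector outside the kernel can be adjoined, since `g` detects its coefficient.
  have h : LinearIndependent A (fun o : Option κ => o.elim w v) := by
    rw [Fintype.linearIndependent_iff]
    intro c hc
    rw [Fintype.sum_option] at hc
    have h0 : c none = 0 := by
      have := congrArg g hc
      simpa [map_sum, hgv, hw] using this
    simp only [h0, zero_smul, zero_add, Option.elim] at hc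
    have h1 := Fintype.linearIndependent_iff.mp hv (fun i => c (some i)) hc
    rintro (_ | i)
    · exact h0
    · exact h1 i
  have := h.fintype_card_le_finrank
  simpa using this

end Freeness

/-! ### Monomial ideals, primes generated by variables, radicals -/

section MonomialIdeals

open MvPolynomial

variable {σ k : Type*} [Field k]

variable (k) in
/-- The ideal generated by the monomials with exponents in `S`. -/
noncomputable def monomialIdeal (S : Set (σ →₀ ℕ)) : Ideal (MvPolynomial σ k) :=
  Ideal.span ((fun e => monomial e (1 : k)) '' S)

/-- The exponent of the radical of a monomial. -/
noncomputable def radicalExponent (e : σ →₀ ℕ) : σ →₀ ℕ := e.mapRange (fun n => min n 1) (by simp)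

@[simp] lemma radicalExponent_apply (e : σ →₀ ℕ) (x : σ) :
    radicalExponent e x = min (e x) 1 := rfl

lemma radicalExponent_mono {e f : σ →₀ ℕ} (h : e ≤ f) : radicalExponent e ≤ radicalExponent f :=
  fun x => by have := h x; simp only [radicalExponent_apply]; omega

lemma radicalExponent_sup (e f : σ →₀ ℕ) :
    radicalExponent (e ⊔ f) = radicalExponent e ⊔ radicalExponent f := by
  ext x; simp only [radicalExponent_apply, Finsupp.sup_apply]; omega

lemma mem_monomialIdeal {S : Set (σ →₀ ℕ)} {f : MvPolynomial σ k} :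
    f ∈ monomialIdeal k S ↔ ∀ d ∈ f.support, ∃ e ∈ S, e ≤ d :=
  mem_ideal_span_monomial_image

lemma monomial_mem_monomialIdeal {S : Set (σ →₀ ℕ)} {d : σ →₀ ℕ} :
    monomial d (1 : k) ∈ monomialIdeal k S ↔ ∃ e ∈ S, e ≤ d := by
  classical
  rw [mem_monomialIdeal, support_monomial, if_neg one_ne_zero]
  simp

lemma monomialIdeal_le_iff {S : Set (σ →₀ ℕ)} {I : Ideal (MvPolynomial σ k)} :
    monomialIdeal k S ≤ I ↔ ∀ e ∈ S, monomial e (1 : k) ∈ I := by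
  rw [monomialIdeal, Ideal.span_le, Set.image_subset_iff]; rfl

/-- Colon by a monomial: truncated subtraction `a - b` is the exponent of `a` divided by its
greatest common divisor with `b`. -/
lemma mem_monomialIdeal_of_mul_monomial_mem {S : Set (σ →₀ ℕ)} {f : MvPolynomial σ k}
    {b : σ →₀ ℕ} (h : f * monomial b 1 ∈ monomialIdeal k S) :
    f ∈ monomialIdeal k ((fun a => a - b) '' S) := by
  rw [mem_monomialIdeal] at h ⊢
  intro d hd
  obtain ⟨e, he, hle⟩ := h (d + b) (by
    rw [mem_support_iff, coeff_mul_monomial, mul_one]; exact mem_support_iff.mp hd)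
  exact ⟨e - b, ⟨e, he, rfl⟩, tsub_le_iff_right.mpr hle⟩

lemma exists_finset_monomialIdeal [Finite σ] {I : Ideal (MvPolynomial σ k)}
    (h : IsMonomialIdeal I) : ∃ S : Finset (σ →₀ ℕ), I = monomialIdeal k (S : Set (σ →₀ ℕ)) := by
  classical
  obtain ⟨S, rfl⟩ := h
  obtain ⟨T, hTS, hT⟩ := (Submodule.fg_span_iff_fg_span_finset_subset _).mp
    (IsNoetherian.noetherian (Ideal.span ((fun e => monomial e (1 : k)) '' S)))
  obtain ⟨T', hT', rfl⟩ := Finset.subset_set_image_iff.mp hTS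
  refine ⟨T', ?_⟩
  rw [monomialIdeal, Ideal.span, hT]
  simp

variable (k) in
/-- The prime ideal generated by the variables in `W`. -/
noncomputable def varIdeal (W : Set σ) : Ideal (MvPolynomial σ k) := Ideal.span (X '' W)

lemma mem_varIdeal {W : Set σ} {f : MvPolynomial σ k} :
    f ∈ varIdeal k W ↔ ∀ m ∈ f.support, ∃ i ∈ W, m i ≠ 0 := mem_ideal_span_X_image

lemma monomial_mem_varIdeal {W : Set σ} {d : σ →₀ ℕ} :
    monomial d (1 : k) ∈ varIdeal k W ↔ ∃ i ∈ W, d i ≠ 0 := by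
  classical
  rw [mem_varIdeal, support_monomial, if_neg one_ne_zero]
  simp

lemma X_mem_varIdeal {W : Set σ} {i : σ} : (X i : MvPolynomial σ k) ∈ varIdeal k W ↔ i ∈ W := by
  classical
  rw [X, monomial_mem_varIdeal]
  constructor
  · rintro ⟨j, hj, h⟩
    rw [Finsupp.single_apply] at h
    split_ifs at h with hij
    · rwa [hij]
    · simp at h
  · exact fun h => ⟨i, h, by simp⟩

instance varIdeal_isPrime (W : Set σ) : (varIdeal k W).IsPrime := by
  classical
  -- The substitution killing the variables in `W` has exactly this ideal as kernel, and its target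
  -- is a domain.
  let φ : MvPolynomial σ k →ₐ[k] MvPolynomial σ k := aeval fun i => if i ∈ W then 0 else X i
  have h1 : ∀ f, f - φ f ∈ varIdeal k W := by
    intro f
    rw [← Ideal.Quotient.mk_eq_mk_iff_sub_mem]
    have : (Ideal.Quotient.mkₐ k (varIdeal k W)) = (Ideal.Quotient.mkₐ k (varIdeal k W)).comp φ := by
      ext i
      simp only [φ, AlgHom.comp_apply, aeval_X]
      split_ifs with hi
      · simpa using Ideal.Quotient.eq_zero_iff_mem.mpr (X_mem_varIdeal.mpr hi)
      · rfl
    exact congrArg (fun g => g f) this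
  have h2 : varIdeal k W = RingHom.ker φ := by
    refine le_antisymm ?_ fun f hf => ?_
    · rw [varIdeal, Ideal.span_le]
      rintro _ ⟨i, hi, rfl⟩
      simp [φ, hi]
    · have := h1 f
      rwa [(RingHom.mem_ker).mp hf, sub_zero] at this
  rw [h2]
  exact RingHom.ker_isPrime _

lemma varIdeal_injective : Function.Injective (varIdeal (σ := σ) k) := by
  intro U V h
  ext i
  rw [← X_mem_varIdeal (k := k), h, X_mem_varIdeal]

lemma varIdeal_strictMono : StrictMono (varIdeal (σ := σ) k) := by
  exact Monotone.strictMono_of_injective (fun U V h => Ideal.span_mono (Set.image_mono h))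
    varIdeal_injective

lemma monomialIdeal_le_varIdeal_iff {S : Set (σ →₀ ℕ)} {W : Set σ} :
    monomialIdeal k S ≤ varIdeal k W ↔ ∀ e ∈ S, ∃ i ∈ W, e i ≠ 0 := by
  simp only [monomialIdeal_le_iff, monomial_mem_varIdeal]

lemma varIdeal_le {P : Ideal (MvPolynomial σ k)} : varIdeal k {i | X i ∈ P} ≤ P := by
  rw [varIdeal, Ideal.span_le]
  rintro _ ⟨i, hi, rfl⟩
  exact hi

lemma monomialIdeal_le_varIdeal {S : Set (σ →₀ ℕ)} {P : Ideal (MvPolynomial σ k)} [hP : P.IsPrime]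
    (h : monomialIdeal k S ≤ P) : monomialIdeal k S ≤ varIdeal k {i | X i ∈ P} := by
  rw [monomialIdeal_le_varIdeal_iff]
  rw [monomialIdeal_le_iff] at h
  intro e he
  have h1 := h e he
  rw [monomial_eq, C_1, one_mul, Finsupp.prod] at h1
  obtain ⟨i, hi, hi'⟩ := (hP.prod_mem_iff).mp h1
  exact ⟨i, hP.mem_of_pow_mem _ hi', Finsupp.mem_support_iff.mp hi⟩

lemma eq_varIdeal_of_mem_minimalPrimes {S : Set (σ →₀ ℕ)} {P : Ideal (MvPolynomial σ k)}
    (h : P ∈ (monomialIdeal k S).minimalPrimes) : P = varIdeal k {i | X i ∈ P} := by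
  have := h.1.1
  exact le_antisymm (h.2 ⟨inferInstance, monomialIdeal_le_varIdeal h.1.2⟩ varIdeal_le) varIdeal_le

lemma radical_monomialIdeal (S : Set (σ →₀ ℕ)) :
    (monomialIdeal k S).radical = monomialIdeal k (radicalExponent '' S) := by
  refine le_antisymm (fun f hf => ?_) ?_
  · rw [mem_monomialIdeal]
    intro d hd
    by_contra! hcon
    -- The variables missing from `d` generate a prime that contains every generator but no
    -- polynomial in which `d` occurs.
    have hle : monomialIdeal k S ≤ varIdeal k {x | d x = 0} := by
      rw [monomialIdeal_le_varIdeal_iff]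
      intro e he
      have := hcon _ ⟨e, he, rfl⟩
      rw [Finsupp.le_def] at this
      push Not at this
      obtain ⟨i, hi⟩ := this
      rw [radicalExponent_apply] at hi
      exact ⟨i, by show d i = 0; omega, by omega⟩
    have h1 := (Ideal.IsPrime.radical_le_iff inferInstance).mpr hle hf
    obtain ⟨i, hi, hi'⟩ := mem_varIdeal.mp h1 d hd
    exact hi' hi
  · rw [monomialIdeal_le_iff]
    rintro _ ⟨e, he, rfl⟩
    -- The degree bounds every exponent of `e`, so this power is large enough.
    refine ⟨e.degree, ?_⟩
    rw [monomial_pow, one_pow, monomial_mem_monomialIdeal]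
    refine ⟨e, he, fun i => ?_⟩
    have := Finsupp.le_degree i e
    simp only [Finsupp.smul_apply, radicalExponent_apply, smul_eq_mul]
    rcases Nat.eq_zero_or_pos (e i) with h | h
    · omega
    · rw [min_eq_right h]; omega

end MonomialIdeals

/-! ### Heights of primes generated by variables -/

section Heights

open MvPolynomial

lemma Ideal.card_le_height_of_strictMono {ι S : Type*} [CommRing S] {f : Finset ι → Ideal S}
    (hf : StrictMono f) (hp : ∀ T, (f T).IsPrime) (T : Finset ι) : (T.card : ℕ∞) ≤ (f T).height := by
  classical
  induction T using Finset.induction_on with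
  | empty => simp
  | insert a T ha ih =>
    have := hp T
    have := hp (insert a T)
    have h := Ideal.height_add_one_le_of_lt_of_isPrime (hf (Finset.ssubset_insert ha))
    rw [Finset.card_insert_of_notMem ha]
    push_cast
    exact (add_le_add_left ih 1).trans h

variable {σ k : Type*} [Field k]

lemma height_varIdeal [Finite σ] (W : Finset σ) : (varIdeal k (W : Set σ)).height = W.card := by
  classical
  refine le_antisymm ?_ ?_
  · have h := Ideal.height_le_card_of_mem_minimalPrimes_span_finset
      (p := varIdeal k (W : Set σ)) (s := W.image (X : σ → MvPolynomial σ k)) (by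
        rw [Finset.coe_image]
        exact ⟨⟨inferInstance, le_rfl⟩, fun q hq _ => hq.2⟩)
    exact h.trans (by exact_mod_cast Finset.card_image_le)
  · exact Ideal.card_le_height_of_strictMono (f := fun T : Finset σ => varIdeal k (T : Set σ))
      (varIdeal_strictMono.comp fun _ _ h => Finset.coe_ssubset.mpr h) (fun _ => inferInstance) W

/-- Adjoining the variables of `T` to `W` one at a time gives distinct primes over `I`. With `T` the
complement of `W`, this bounds the dimension of the quotient at the origin from below. -/
lemma card_le_height_map_varIdeal [DecidableEq σ] {I : Ideal (MvPolynomial σ k)} {W : Finset σ}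
    (hI : I ≤ varIdeal k (W : Set σ)) {T : Finset σ} (hT : Disjoint W T) :
    (T.card : ℕ∞) ≤ ((varIdeal k ((W ∪ T : Finset σ) : Set σ)).map (Ideal.Quotient.mk I)).height := by
  let f : Finset {i // i ∉ W} → Ideal (MvPolynomial σ k ⧸ I) := fun U =>
    (varIdeal k ((W ∪ U.map (.subtype _) : Finset σ) : Set σ)).map (Ideal.Quotient.mk I)
  have hle : ∀ U : Finset σ, I ≤ varIdeal k ((W ∪ U : Finset σ) : Set σ) := fun U =>
    hI.trans (varIdeal_strictMono.monotone (by simp))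
  have hcomap : ∀ U : Finset σ, ((varIdeal k ((W ∪ U : Finset σ) : Set σ)).map
      (Ideal.Quotient.mk I)).comap (Ideal.Quotient.mk I) = varIdeal k ((W ∪ U : Finset σ) : Set σ) := by
    intro U
    rw [Ideal.comap_map_of_surjective _ Ideal.Quotient.mk_surjective, ← RingHom.ker_eq_comap_bot,
      Ideal.mk_ker, sup_eq_left.mpr (hle U)]
  have hmono : StrictMono f := by
    refine Monotone.strictMono_of_injective (fun U V h => Ideal.map_mono
      (varIdeal_strictMono.monotone ?_)) ?_
    · exact_mod_cast Finset.union_subset_union le_rfl (Finset.map_subset_map.mpr h)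
    · intro U V h
      have h1 := congrArg (Ideal.comap (Ideal.Quotient.mk I)) h
      simp only [f, hcomap] at h1
      have h2 := varIdeal_injective h1
      rw [Finset.coe_inj] at h2
      ext ⟨i, hi⟩
      have := congrArg (fun s => i ∈ s) h2
      simpa [hi] using this
  have hT' : T = (T.subtype (· ∉ W)).map (.subtype _) := by
    ext i
    simpa using fun h h' => (Finset.disjoint_left.mp hT) h' h
  have := Ideal.card_le_height_of_strictMono hmono (fun U =>
    Ideal.map_isPrime_of_surjective Ideal.Quotient.mk_surjective (by rw [Ideal.mk_ker]; exact hle _))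
    (T.subtype (· ∉ W))
  simp only [f, ← hT'] at this
  refine le_trans ?_ this
  conv_lhs => rw [hT', Finset.card_map]

end Heights

/-! ### Taylor syzygies of monomials -/

section Taylor

open MvPolynomial

variable {σ k ι : Type*} [Field k] [DecidableEq ι]

variable (k) in
/-- The syzygy of the monomials with exponents `a i` and `a j` given by their least common
multiple. -/
noncomputable def taylorSyzygy (a : ι → σ →₀ ℕ) (i j : ι) : ι → MvPolynomial σ k :=
  Pi.single i (monomial (a j - a i) 1) - Pi.single j (monomial (a i - a j) 1)

lemma monomial_tsub_mul (a b : σ →₀ ℕ) :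
    monomial (b - a) (1 : k) * monomial a 1 = monomial (a ⊔ b) 1 := by
  rw [monomial_mul, one_mul]
  congr 2
  ext x
  simp only [Finsupp.add_apply, Finsupp.tsub_apply, Finsupp.sup_apply]
  omega

lemma sum_taylorSyzygy_mul [Fintype ι] (a : ι → σ →₀ ℕ) (i j : ι) :
    ∑ l, taylorSyzygy k a i j l * monomial (a l) 1 = 0 := by
  simp only [taylorSyzygy, Pi.sub_apply, sub_mul, Finset.sum_sub_distrib, Pi.single_apply, ite_mul,
    zero_mul, Finset.sum_ite_eq', Finset.mem_univ, if_true, monomial_tsub_mul]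
  rw [sup_comm, sub_self]

/-- Induction on the support: the coordinate `z n` lies in the colon of the remaining monomials by
the `n`-th, whose generators are the `n`-th coordinates of Taylor syzygies; subtracting these clears
it. -/
lemma mem_span_taylorSyzygy [Fintype ι] (a : ι → σ →₀ ℕ) (z : ι → MvPolynomial σ k)
    (hz : ∑ l, z l * monomial (a l) 1 = 0) :
    z ∈ Submodule.span (MvPolynomial σ k) (Set.range fun p : ι × ι => taylorSyzygy k a p.1 p.2) := by
  suffices H : ∀ (s : Finset ι) (z : ι → MvPolynomial σ k), (∀ i ∉ s, z i = 0) →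
      ∑ l, z l * monomial (a l) 1 = 0 → z ∈ Submodule.span (MvPolynomial σ k)
        (Set.range fun p : ι × ι => taylorSyzygy k a p.1 p.2) from
    H Finset.univ z (by simp) hz
  intro s
  induction s using Finset.induction_on with
  | empty =>
    intro z h0 _
    have : z = 0 := funext fun i => h0 i (by simp)
    rw [this]; exact Submodule.zero_mem _
  | insert n s hn ih =>
    intro z h0 hz
    have hsum : ∑ l, z l * monomial (a l) (1 : k) = z n * monomial (a n) 1 +
        ∑ l ∈ s, z l * monomial (a l) 1 := by
      rw [← Finset.sum_insert (f := fun l => z l * monomial (a l) (1 : k)) hn]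
      refine (Finset.sum_subset (Finset.subset_univ _) fun l _ hl => ?_).symm
      rw [h0 l hl, zero_mul]
    have hmem : z n * monomial (a n) 1 ∈ monomialIdeal k (a '' s) := by
      rw [hsum] at hz
      rw [eq_neg_of_add_eq_zero_left hz]
      refine neg_mem (Ideal.sum_mem _ fun l hl => Ideal.mul_mem_left _ _
        (Ideal.subset_span ⟨_, ⟨l, hl, rfl⟩, rfl⟩))
    have h2 := mem_monomialIdeal_of_mul_monomial_mem hmem
    rw [monomialIdeal, Set.image_image, Set.image_image, Ideal.span,
      Submodule.mem_span_image_finset_iff_exists_fun'] at h2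
    obtain ⟨c, hc⟩ := h2
    have hsub : z - ∑ l ∈ s, c l • taylorSyzygy k a n l ∈ Submodule.span (MvPolynomial σ k)
        (Set.range fun p : ι × ι => taylorSyzygy k a p.1 p.2) := by
      refine ih _ ?_ ?_
      · intro i hi
        by_cases hin : i = n
        · subst hin
          have : ∀ l ∈ s, taylorSyzygy k a i l i = monomial (a l - a i) 1 := by
            intro l hl
            have : i ≠ l := fun h => hn (h ▸ hl)
            simp [taylorSyzygy, this]
          simp only [Pi.sub_apply, Finset.sum_apply, Pi.smul_apply]
          rw [Finset.sum_congr rfl fun l hl => by rw [this l hl], hc, sub_self]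
        · have h1 : z i = 0 := h0 i (by simp [hi, hin])
          have : ∀ l ∈ s, taylorSyzygy k a n l i = 0 := by
            intro l hl
            have : i ≠ l := fun h => hi (h ▸ hl)
            simp [taylorSyzygy, this, hin]
          simp only [Pi.sub_apply, Finset.sum_apply, Pi.smul_apply]
          rw [Finset.sum_congr rfl fun l hl => by rw [this l hl, smul_zero]]
          simp [h1]
      · simp only [Pi.sub_apply, sub_mul, Finset.sum_sub_distrib, hz, Finset.sum_apply,
          Pi.smul_apply, smul_eq_mul, Finset.sum_mul, zero_sub, neg_eq_zero]
        rw [Finset.sum_comm]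
        refine Finset.sum_eq_zero fun l _ => ?_
        simp only [mul_assoc, ← Finset.mul_sum, sum_taylorSyzygy_mul, mul_zero]
    have : z = (z - ∑ l ∈ s, c l • taylorSyzygy k a n l) + ∑ l ∈ s, c l • taylorSyzygy k a n l := by
      abel
    rw [this]
    exact Submodule.add_mem _ hsub (Submodule.sum_mem _ fun l _ => Submodule.smul_mem _ _
      (Submodule.subset_span ⟨(n, l), rfl⟩))

end Taylor

/-! ### From Cohen–Macaulayness to connecting pairs of generators -/

section TaylorBasis

open MvPolynomial IsLocalRing RingTheory.Sequence

/-- The depth lemma applied along `0 → range g → A → B → 0` and then `0 → ker g → A^ι → range g →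
0`, gaining one unit each time. -/
lemma DepthGE.ker_of_range_eq_ker {A B : Type u} [CommRing A] [IsLocalRing A] [IsNoetherianRing A]
    [CommRing B] [Algebra A B] (hsurj : Function.Surjective (algebraMap A B)) {ι : Type} [Finite ι]
    {n : ℕ} (g : (ι → A) →ₗ[A] A)
    (hg : LinearMap.range g = LinearMap.ker (Algebra.linearMap A B))
    (hA : DepthGE A A (n + 2)) (hB : DepthGE A B n) : DepthGE A (LinearMap.ker g) (n + 2) := by
  have h1 : DepthGE A (LinearMap.range g) (n + 1) := by
    refine DepthGE.of_exact_left (f := (LinearMap.range g).subtype) (g := Algebra.linearMap A B)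
      (Submodule.subtype_injective _) ?_ hsurj (hA.mono (by omega)) hB
    rw [LinearMap.exact_iff, Submodule.range_subtype, hg]
  refine DepthGE.of_exact_left (f := (LinearMap.ker g).subtype) (g := g.rangeRestrict)
    (Submodule.subtype_injective _) ?_ g.surjective_rangeRestrict (hA.pi ι) h1
  rw [LinearMap.exact_iff, Submodule.range_subtype, LinearMap.ker_rangeRestrict]

/-- The variables in a height-two prime over the ideal already generate a prime over it; comparing
heights from both sides leaves exactly two of them. -/
lemma exists_card_eq_two_of_height_eq_two {σ k : Type*} [Field k] [Finite σ] {S : Set (σ →₀ ℕ)}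
    (h : (monomialIdeal k S).height = 2) :
    ∃ W : Finset σ, W.card = 2 ∧ monomialIdeal k S ≤ varIdeal k (W : Set σ) := by
  classical
  have := Fintype.ofFinite σ
  obtain ⟨P, hP, hle, hht⟩ := Ideal.exists_isPrime_height_eq (n := 2) h
  refine ⟨Finset.univ.filter fun i => X i ∈ P, ?_, ?_⟩
  · have h1 := monomialIdeal_le_varIdeal hle
    have h2 : ((Finset.univ.filter fun i => X i ∈ P : Finset σ) : Set σ) = {i | X i ∈ P} := by
      ext; simp
    rw [← h2] at h1
    have h3 := Ideal.height_mono h1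
    have h4 := Ideal.height_mono (varIdeal_le (P := P))
    rw [← h2] at h4
    rw [height_varIdeal, h] at h3
    rw [height_varIdeal, hht] at h4
    exact le_antisymm (by exact_mod_cast h4) (by exact_mod_cast h3)
  · have := monomialIdeal_le_varIdeal hle
    simpa using this

lemma mem_span_map_taylorSyzygy {σ k ι A : Type*} [Field k] [Fintype ι] [DecidableEq ι] [CommRing A]
    [Algebra (MvPolynomial σ k) A] (M : Submonoid (MvPolynomial σ k)) [IsLocalization M A]
    (hM : M ≤ nonZeroDivisors (MvPolynomial σ k)) (a : ι → σ →₀ ℕ) (z : ι → A)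
    (hz : ∑ l, z l * algebraMap (MvPolynomial σ k) A (monomial (a l) 1) = 0) :
    z ∈ Submodule.span A (Set.range fun p : ι × ι =>
      algebraMap (MvPolynomial σ k) A ∘ taylorSyzygy k a p.1 p.2) := by
  obtain ⟨b, hb⟩ := IsLocalization.exist_integer_multiples_of_finite M z
  choose w hw using hb
  have hinj := IsLocalization.injective A hM
  have hw0 : ∑ l, w l * monomial (a l) 1 = 0 := by
    apply hinj
    rw [map_sum, map_zero]
    simp only [map_mul, hw, Algebra.smul_mul_assoc, ← Finset.smul_sum, hz, smul_zero]
  have h1 := mem_span_taylorSyzygy a w hw0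
  have h2 : algebraMap (MvPolynomial σ k) A ∘ w ∈ Submodule.span A (Set.range fun p : ι × ι =>
      algebraMap (MvPolynomial σ k) A ∘ taylorSyzygy k a p.1 p.2) := by
    let T : (ι → MvPolynomial σ k) →ₗ[MvPolynomial σ k] (ι → A) :=
      (Algebra.linearMap (MvPolynomial σ k) A).compLeft ι
    have h3 : T w ∈ (Submodule.span (MvPolynomial σ k)
        (Set.range fun p : ι × ι => taylorSyzygy k a p.1 p.2)).map T :=
      Submodule.mem_map_of_mem h1
    rw [Submodule.map_span, ← Set.range_comp] at h3
    exact Submodule.span_le_restrictScalars (MvPolynomial σ k) A _ h3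
  have h3 : algebraMap (MvPolynomial σ k) A ∘ w = algebraMap (MvPolynomial σ k) A b • z := by
    ext l
    simp [hw, Algebra.smul_def]
  rw [h3] at h2
  obtain ⟨c, hc⟩ := (IsLocalization.map_units A b).exists_left_inv
  have := Submodule.smul_mem _ c h2
  rwa [smul_smul, hc, one_smul] at this

/-- Let `C` be the component of `i` and pair vectors with the monomials indexed by `C`. A selected
pair bounded by `α` has both ends in `C` or neither and gives zero; any other selected pair gives an
element of the ideal of monomials not dividing `α`. If `j ∉ C`, the syzygy of `i` and `j` gives the
monomial `α` itself, which is not in that ideal, even after localization, since denominators have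
non-zero constant term. -/
lemma eqvGen_of_mem_span_taylorSyzygy {σ k ι A : Type*} [Field k] [Fintype ι] [DecidableEq ι]
    [CommRing A] [Algebra (MvPolynomial σ k) A] (M : Submonoid (MvPolynomial σ k))
    [IsLocalization M A] (hM : ∀ s ∈ M, coeff 0 s ≠ 0) (a : ι → σ →₀ ℕ) (E : Finset (ι × ι))
    (i j : ι) (h : algebraMap (MvPolynomial σ k) A ∘ taylorSyzygy k a i j ∈
      Submodule.span A ((fun p : ι × ι => algebraMap (MvPolynomial σ k) A ∘
        taylorSyzygy k a p.1 p.2) '' E)) :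
    Relation.EqvGen (fun p q => (p, q) ∈ E ∧ a p ⊔ a q ≤ a i ⊔ a j) i j := by
  classical
  by_contra hcon
  set α := a i ⊔ a j with hα
  let rel : ι → ι → Prop := fun p q => (p, q) ∈ E ∧ a p ⊔ a q ≤ α
  let C : Finset ι := Finset.univ.filter fun l => Relation.EqvGen rel i l
  have hiC : i ∈ C := by simp [C, Relation.EqvGen.refl]
  have hjC : j ∉ C := fun h => hcon (Finset.mem_filter.mp h).2
  let c : ι → MvPolynomial σ k := fun l => if l ∈ C then monomial (a l) 1 else 0
  let L : (ι → A) →ₗ[A] A := Fintype.linearCombination A (algebraMap (MvPolynomial σ k) A ∘ c)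
  let T : Set (σ →₀ ℕ) := {t | ¬ t ≤ α}
  have hLt : ∀ p q : ι, L (algebraMap (MvPolynomial σ k) A ∘ taylorSyzygy k a p q) =
      algebraMap (MvPolynomial σ k) A ((if p ∈ C then monomial (a p ⊔ a q) 1 else 0) -
        (if q ∈ C then monomial (a p ⊔ a q) 1 else 0)) := by
    intro p q
    have h1 : L (algebraMap (MvPolynomial σ k) A ∘ taylorSyzygy k a p q) =
        algebraMap (MvPolynomial σ k) A (∑ l, taylorSyzygy k a p q l * c l) := by
      simp only [L, Fintype.linearCombination_apply, map_sum, map_mul, smul_eq_mul,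
        Function.comp_apply]
    rw [h1]
    congr 1
    simp only [taylorSyzygy, Pi.sub_apply, sub_mul, Finset.sum_sub_distrib, Pi.single_apply,
      ite_mul, zero_mul, Finset.sum_ite_eq', Finset.mem_univ, if_true]
    simp only [c, mul_ite, mul_zero, monomial_tsub_mul]
    rw [sup_comm (a q)]
  have hLE : ∀ q ∈ E, L (algebraMap (MvPolynomial σ k) A ∘ taylorSyzygy k a q.1 q.2) ∈
      (monomialIdeal k T).map (algebraMap (MvPolynomial σ k) A) := by
    intro q hq
    rw [hLt]
    apply Ideal.mem_map_of_mem
    by_cases hle : a q.1 ⊔ a q.2 ≤ α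
    · have hrel : rel q.1 q.2 := ⟨hq, hle⟩
      have : q.1 ∈ C ↔ q.2 ∈ C := by
        simp only [C, Finset.mem_filter, Finset.mem_univ, true_and]
        exact ⟨fun h => h.trans _ _ _ (.rel _ _ hrel),
          fun h => h.trans _ _ _ (.symm _ _ (.rel _ _ hrel))⟩
      simp [this]
    · have hT : monomial (a q.1 ⊔ a q.2) (1 : k) ∈ monomialIdeal k T :=
        monomial_mem_monomialIdeal.mpr ⟨_, hle, le_rfl⟩
      refine sub_mem ?_ ?_ <;> split_ifs <;> first | exact hT | exact zero_mem _
  have hLij : algebraMap (MvPolynomial σ k) A (monomial α 1) ∈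
      (monomialIdeal k T).map (algebraMap (MvPolynomial σ k) A) := by
    have h1 : L (algebraMap (MvPolynomial σ k) A ∘ taylorSyzygy k a i j) =
        algebraMap (MvPolynomial σ k) A (monomial α 1) := by
      rw [hLt]; simp [hiC, hjC, hα]
    rw [← h1]
    have h3 : Submodule.span A ((fun p : ι × ι => algebraMap (MvPolynomial σ k) A ∘
        taylorSyzygy k a p.1 p.2) '' E) ≤ Submodule.comap L
          ((monomialIdeal k T).map (algebraMap (MvPolynomial σ k) A)) := by
      rw [Submodule.span_le]
      rintro _ ⟨q, hq, rfl⟩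
      exact hLE q hq
    exact h3 h
  rw [IsLocalization.algebraMap_mem_map_algebraMap_iff M] at hLij
  obtain ⟨s, hs, hsα⟩ := hLij
  rw [mem_monomialIdeal] at hsα
  obtain ⟨t, ht, hle⟩ := hsα α (by
    rw [mem_support_iff]
    have := coeff_mul_monomial (R := k) 0 α 1 s
    rw [zero_add, mul_one] at this
    rw [this]
    exact hM s hs)
  exact ht hle

/-- Over a suitable localization with a Cohen–Macaulay quotient of codimension two, the syzygies
have a basis of Taylor syzygies. -/
lemma exists_finset_span_taylorSyzygy {k A B : Type u} [Field k] {σ ι : Type}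
    [Fintype ι] [Nonempty ι] [DecidableEq ι] [CommRing A] [IsLocalRing A] [IsNoetherianRing A]
    [Algebra (MvPolynomial σ k) A] (M : Submonoid (MvPolynomial σ k)) [IsLocalization M A]
    (hM : M ≤ nonZeroDivisors (MvPolynomial σ k)) (a : ι → σ →₀ ℕ)
    [CommRing B] [Algebra A B] (hsurj : Function.Surjective (algebraMap A B))
    (hker : RingHom.ker (algebraMap A B) =
      (monomialIdeal k (Set.range a)).map (algebraMap (MvPolynomial σ k) A)) {n : ℕ}
    (hA : DepthGE A A (n + 2)) (hB : DepthGE A B n) {rs : List A}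
    (hrs : Ideal.ofList rs = maximalIdeal A) (hlen : rs.length = n + 2) :
    ∃ E : Finset (ι × ι), E.card + 1 ≤ Fintype.card ι ∧ ∀ i j,
      algebraMap (MvPolynomial σ k) A ∘ taylorSyzygy k a i j ∈
        Submodule.span A ((fun p : ι × ι => algebraMap (MvPolynomial σ k) A ∘
          taylorSyzygy k a p.1 p.2) '' E) := by
  let mon : ι → A := fun i => algebraMap (MvPolynomial σ k) A (monomial (a i) 1)
  let g : (ι → A) →ₗ[A] A := Fintype.linearCombination A mon
  have hgapp : ∀ z, g z = ∑ l, z l * mon l := fun z => by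
    simp [g, Fintype.linearCombination_apply]
  have hgr : LinearMap.range g = LinearMap.ker (Algebra.linearMap A B) := by
    have h1 : LinearMap.ker (Algebra.linearMap A B) = RingHom.ker (algebraMap A B) := rfl
    rw [h1, hker, Fintype.range_linearCombination, monomialIdeal, Ideal.map_span,
      ← Set.range_comp, ← Set.range_comp]
    rfl
  have hZ : DepthGE A (LinearMap.ker g) (n + 2) :=
    DepthGE.ker_of_range_eq_ker hsurj g hgr hA hB
  have hZreg : IsWeaklyRegular (LinearMap.ker g) rs := by
    refine DepthGE.isWeaklyRegular (fun x hx => ?_) (by rw [hrs]; exact le_sup_right)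
      (by rw [hlen]; exact hZ)
    rw [← hrs]; exact Ideal.subset_span hx
  let v : ι × ι → LinearMap.ker g := fun q =>
    ⟨algebraMap (MvPolynomial σ k) A ∘ taylorSyzygy k a q.1 q.2, by
      rw [LinearMap.mem_ker, hgapp]
      have := congrArg (algebraMap (MvPolynomial σ k) A) (sum_taylorSyzygy_mul (k := k) a q.1 q.2)
      simpa [map_sum] using this⟩
  have himg : ∀ s : Set (ι × ι), (LinearMap.ker g).subtype '' (v '' s) =
      (fun q : ι × ι => algebraMap (MvPolynomial σ k) A ∘ taylorSyzygy k a q.1 q.2) '' s := by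
    intro s
    rw [← Set.image_comp]; rfl
  have hv : Submodule.span A (Set.range v) = ⊤ := by
    rw [eq_top_iff]
    rintro ⟨z, hz⟩ -
    have h1 := mem_span_map_taylorSyzygy M hM a z (by
      rw [LinearMap.mem_ker, hgapp] at hz; exact hz)
    rw [← Set.image_univ, ← himg, ← Submodule.map_span] at h1
    obtain ⟨y, hy, hyz⟩ := Submodule.mem_map.mp h1
    have : y = ⟨z, hz⟩ := Subtype.ext hyz
    rwa [← this, ← Set.image_univ]
  obtain ⟨E, hEind, hEspan⟩ := exists_finset_linearIndependent_span_eq_top hZreg hrs v hv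
  have hAdom : IsDomain A := IsLocalization.isDomain_of_le_nonZeroDivisors _ hM
  have hinj : Function.Injective (algebraMap (MvPolynomial σ k) A) :=
    IsLocalization.injective A hM
  refine ⟨E, ?_, fun i j => ?_⟩
  · obtain ⟨i₀⟩ := ‹Nonempty ι›
    have hg0 : g ≠ 0 := by
      intro h
      have h1 : g (Pi.single i₀ 1) = mon i₀ := by simp [g]
      rw [h, LinearMap.zero_apply] at h1
      have h2 : (monomial (a i₀) (1 : k)) = 0 := hinj (by rw [map_zero]; exact h1.symm)
      simp at h2
    have hind := hEind.map' (LinearMap.ker g).subtype (Submodule.ker_subtype _)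
    have := hind.card_add_one_le_of_mem_ker hg0 (fun q => (v q).2)
    simpa using this
  · have h1 : v (i, j) ∈ Submodule.span A (v '' E) := by rw [hEspan]; trivial
    have h2 := Submodule.mem_map_of_mem (f := (LinearMap.ker g).subtype) h1
    rwa [Submodule.map_span, himg] at h2

set_option maxHeartbeats 1000000 in
/-- If `R ⧸ I` is Cohen–Macaulay of codimension two, there are fewer pairs of generators than
generators such that any two generators are connected by a chain of pairs with least common
multiples dividing the least common multiple of the two. -/
theorem exists_connecting_pairs_of_isCohenMacaulayRing {k : Type u} [Field k] {r : ℕ} {ι : Type}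
    [Fintype ι] [DecidableEq ι] (a : ι → Fin r →₀ ℕ)
    (hcodim : (monomialIdeal k (Set.range a)).height = 2)
    (hCM : IsCohenMacaulayRing (MvPolynomial (Fin r) k ⧸ monomialIdeal k (Set.range a))) :
    ∃ E : Finset (ι × ι), E.card + 1 ≤ Fintype.card ι ∧
      ∀ i j, Relation.EqvGen (fun p q => (p, q) ∈ E ∧ a p ⊔ a q ≤ a i ⊔ a j) i j := by
  classical
  obtain ⟨W, hW, hIW⟩ := exists_card_eq_two_of_height_eq_two hcodim
  have hne : Nonempty ι := by
    by_contra hemp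
    rw [not_nonempty_iff] at hemp
    have : monomialIdeal k (Set.range a) = ⊥ := by rw [monomialIdeal]; simp
    rw [this, Ideal.height_bot] at hcodim
    simp at hcodim
  generalize hI : monomialIdeal k (Set.range a) = I at *
  have hIm : I ≤ varIdeal k (Finset.univ : Finset (Fin r)) :=
    hIW.trans (varIdeal_strictMono.monotone (by simp))
  have hdim := card_le_height_map_varIdeal hIW (disjoint_compl_right : Disjoint W Wᶜ)
  rw [Finset.union_compl] at hdim
  set p := (varIdeal k ((Finset.univ : Finset (Fin r)) : Set (Fin r))).map (Ideal.Quotient.mk I)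
    with hp
  have hpp : p.IsPrime := Ideal.map_isPrime_of_surjective Ideal.Quotient.mk_surjective
    (by rw [Ideal.mk_ker]; exact hIm)
  have hP : p.comap (Ideal.Quotient.mk I) =
      varIdeal k ((Finset.univ : Finset (Fin r)) : Set (Fin r)) := by
    rw [hp, Ideal.comap_map_of_surjective _ Ideal.Quotient.mk_surjective, ← RingHom.ker_eq_comap_bot,
      Ideal.mk_ker, sup_eq_left.mpr hIm]
  clear_value p
  -- Localizing at the preimage, rather than at the equal ideal of all variables, provides the local
  -- homomorphism to `B` directly.
  let A := Localization.AtPrime (p.comap (Ideal.Quotient.mk I))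
  let B := Localization.AtPrime p
  have hreg : IsRegularLocalRing A := IsRegularRing.isRegularLocalRing_localization _
  let φ : A →+* B := Localization.localRingHom _ p (Ideal.Quotient.mk I) rfl
  algebraize [φ]
  have hsurj : Function.Surjective (algebraMap A B) :=
    RingHom.surjective_localRingHom_of_surjective _ Ideal.Quotient.mk_surjective p
  have hker : RingHom.ker (algebraMap A B) = I.map (algebraMap (MvPolynomial (Fin r) k) A) :=
    Ideal.ker_localRingHom_mk I p
  have hr : Wᶜ.card + 2 = r := by
    rw [Finset.card_compl, Fintype.card_fin]
    have := Finset.card_le_univ W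
    rw [Fintype.card_fin] at this
    omega
  have hB : DepthGE A B Wᶜ.card := by
    refine DepthGE.of_isCohenMacaulayLocalRing hsurj (hCM.localization p) ?_
    rw [IsLocalization.AtPrime.ringKrullDim_eq_height p]
    exact_mod_cast hdim
  have hA : DepthGE A A (Wᶜ.card + 2) := by
    refine depthGE_of_isRegularLocalRing A ?_
    rw [IsLocalization.AtPrime.ringKrullDim_eq_height (p.comap (Ideal.Quotient.mk I)), hP,
      height_varIdeal, Finset.card_univ, Fintype.card_fin, hr]
    exact le_rfl
  have hrs : Ideal.ofList (List.ofFn fun i : Fin r =>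
      algebraMap (MvPolynomial (Fin r) k) A (X i)) = maximalIdeal A := by
    have h1 := congrArg (Ideal.map (algebraMap (MvPolynomial (Fin r) k) A)) hP
    refine Eq.trans ?_ (h1.symm.trans Localization.AtPrime.map_eq_maximalIdeal)
    rw [varIdeal, Ideal.map_span, Ideal.ofList]
    congr 1
    ext x
    simp
  have hnzd := Ideal.primeCompl_le_nonZeroDivisors (p.comap (Ideal.Quotient.mk I))
  obtain ⟨E, hE, hspan⟩ := exists_finset_span_taylorSyzygy (A := A) (B := B) _ hnzd a hsurj (by rw [hI]; exact hker)
    hA hB hrs (by rw [List.length_ofFn, hr])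
  have hM : ∀ s ∈ (p.comap (Ideal.Quotient.mk I)).primeCompl, coeff 0 s ≠ 0 := by
    intro s hs h0
    have hs' : s ∉ p.comap (Ideal.Quotient.mk I) := hs
    apply hs'
    rw [hP, mem_varIdeal]
    intro d hd
    have : d ≠ 0 := by rintro rfl; exact mem_support_iff.mp hd h0
    obtain ⟨x, hx⟩ := Finsupp.ne_iff.mp this
    exact ⟨x, by simp, hx⟩
  exact ⟨E, hE, fun i j => eqvGen_of_mem_span_taylorSyzygy (A := A) _ hM a E i j (hspan i j)⟩

end TaylorBasis

/-! ### Combinatorics of connecting pairs: contraction, pruning, leaf order -/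

section TreeOrder

open Relation

/-- Pruning and leaf removal use only the end edges of a chain, which have to be genuine edges to
another vertex. -/
lemma Relation.EqvGen.exists_rel_of_ne {α : Type*} {r : α → α → Prop} {x y : α} (h : EqvGen r x y)
    (hne : x ≠ y) : (∃ u, u ≠ x ∧ (r x u ∨ r u x)) ∧ ∃ u, u ≠ y ∧ (r y u ∨ r u y) := by
  induction h with
  | rel x y h => exact ⟨⟨y, hne.symm, .inl h⟩, ⟨x, hne, .inr h⟩⟩
  | refl => exact absurd rfl hne
  | symm x y _ ih => exact (ih hne.symm).symm
  | trans x y z _ _ ih1 ih2 =>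
    by_cases h1 : x = y
    · subst h1; exact ih2 hne
    · by_cases h2 : y = z
      · subst h2; exact ih1 h1
      · exact ⟨(ih1 h1).1, (ih2 h2).2⟩

lemma Relation.EqvGen.map {α β : Type*} {r : α → α → Prop} {s : β → β → Prop} (f : α → β)
    (h : ∀ x y, r x y → f x = f y ∨ s (f x) (f y)) {x y : α} (hxy : EqvGen r x y) :
    EqvGen s (f x) (f y) := by
  induction hxy with
  | rel x y hr =>
    rcases h x y hr with h | h
    · rw [h]; exact .refl _
    · exact .rel _ _ h
  | refl => exact .refl _
  | symm _ _ _ ih => exact ih.symm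
  | trans _ _ _ _ _ ih1 ih2 => exact ih1.trans _ _ _ ih2

variable {V L : Type*} [SemilatticeSup L]

/-- The relation generated by those pairs of `E` whose labels are bounded by `c`. -/
def boundedPair (E : Finset (V × V)) (s : V → L) (c : L) (p q : V) : Prop :=
  (p, q) ∈ E ∧ s p ⊔ s q ≤ c

/-- `E` is a set of fewer pairs of elements of `S` than elements of `S`, such that any two elements
are connected by a chain of pairs bounded by the supremum of their labels. -/
structure IsConnecting (s : V → L) (S : Finset V) (E : Finset (V × V)) : Prop where
  mem : ∀ e ∈ E, e.1 ∈ S ∧ e.2 ∈ S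
  card : E.card + 1 ≤ S.card
  conn : ∀ i ∈ S, ∀ j ∈ S, EqvGen (boundedPair E s (s i ⊔ s j)) i j

namespace IsConnecting

variable {s : V → L} {S : Finset V} {E : Finset (V × V)}

/-- Contracting the pair `{w, u}` onto `u`. -/
lemma contract [DecidableEq V] (h : IsConnecting s S E) {w u : V} (hw : w ∈ S) (hu : u ∈ S)
    (hne : u ≠ w) (hwu : (w, u) ∈ E ∨ (u, w) ∈ E)
    (hle : ∀ c : L, ∀ q, ((w, q) ∈ E ∨ (q, w) ∈ E) → s w ≤ c → s q ≤ c → s u ≤ c) :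
    ∃ E', IsConnecting s (S.erase w) E' := by
  obtain ⟨e, heE, he⟩ : ∃ e ∈ E, (e = (w, u) ∨ e = (u, w)) := by
    rcases hwu with h | h
    · exact ⟨_, h, .inl rfl⟩
    · exact ⟨_, h, .inr rfl⟩
  let f : V → V := fun x => if x = w then u else x
  have hf : ∀ x ∈ S, f x ∈ S.erase w := by
    intro x hx
    simp only [f]
    split_ifs with hxw
    · exact Finset.mem_erase.mpr ⟨hne, hu⟩
    · exact Finset.mem_erase.mpr ⟨hxw, hx⟩
  -- The contracted edge is erased, so the edge count falls with the vertex count; the other edges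
  -- may merge, which only helps.
  refine ⟨(E.erase e).image (Prod.map f f), ?_, ?_, ?_⟩
  · intro e' he'
    obtain ⟨a, ha, rfl⟩ := Finset.mem_image.mp he'
    have := h.mem a (Finset.mem_of_mem_erase ha)
    exact ⟨hf _ this.1, hf _ this.2⟩
  · have h1 := Finset.card_image_le (s := E.erase e) (f := Prod.map f f)
    have h2 := Finset.card_erase_of_mem heE
    have h3 := Finset.card_erase_of_mem hw
    have h4 := h.card
    have h5 : 0 < E.card := Finset.card_pos.mpr ⟨e, heE⟩
    omega
  · intro i hi j hj
    rw [Finset.mem_erase] at hi hj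
    have hfi : f i = i := by simp [f, hi.1]
    have hfj : f j = j := by simp [f, hj.1]
    have := (h.conn i hi.2 j hj.2).map (s := boundedPair ((E.erase e).image (Prod.map f f)) s
      (s i ⊔ s j)) f ?_
    · rwa [hfi, hfj] at this
    · rintro x y ⟨hxy, hc⟩
      by_cases hxe : (x, y) = e
      · left
        rw [hxe.symm] at he
        rcases he with he | he <;> · simp only [Prod.mk.injEq] at he; simp [f, he.1, he.2]
      · right
        refine ⟨Finset.mem_image.mpr ⟨(x, y), Finset.mem_erase.mpr ⟨hxe, hxy⟩, rfl⟩, ?_⟩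
        have hx : s x ≤ s i ⊔ s j := le_sup_left.trans hc
        have hy : s y ≤ s i ⊔ s j := le_sup_right.trans hc
        refine sup_le ?_ ?_
        · simp only [f]; split_ifs with hxw
          · subst hxw; exact hle _ _ (.inl hxy) hx hy
          · exact hx
        · simp only [f]; split_ifs with hyw
          · subst hyw; exact hle _ _ (.inr hxy) hy hx
          · exact hy

/-- Any set of labels can be pruned to an antichain of minimal labels. -/
lemma exists_antichain [DecidableEq V] (h : IsConnecting s S E) :
    ∃ S' E', IsConnecting s S' E' ∧ S' ⊆ S ∧ (∀ x ∈ S, ∃ y ∈ S', s y ≤ s x) ∧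
      ∀ x ∈ S', ∀ y ∈ S', s x ≤ s y → x = y := by
  obtain ⟨n, hn⟩ : ∃ n, S.card = n := ⟨_, rfl⟩
  induction n generalizing S E with
  | zero => have := h.card; omega
  | succ n ih =>
    by_cases hanti : ∀ x ∈ S, ∀ y ∈ S, s x ≤ s y → x = y
    · exact ⟨S, E, h, subset_rfl, fun x hx => ⟨x, hx, le_rfl⟩, hanti⟩
    · push Not at hanti
      obtain ⟨v, hv, w, hw, hle, hne⟩ := hanti
      -- The chain from `v` to `w` is bounded by `s v ⊔ s w = s w`, so its last edge gives a
      -- neighbour of `w` with label at most `s w`.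
      obtain ⟨-, u, huw, hr⟩ := (h.conn v hv w hw).exists_rel_of_ne hne
      have hsu : s u ≤ s w := by
        rcases hr with hr | hr
        · exact (le_sup_right.trans hr.2).trans (sup_le hle le_rfl)
        · exact (le_sup_left.trans hr.2).trans (sup_le hle le_rfl)
      have hE : (w, u) ∈ E ∨ (u, w) ∈ E := hr.imp And.left And.left
      have hu : u ∈ S := by
        rcases hE with h' | h'
        · exact (h.mem _ h').2
        · exact (h.mem _ h').1
      obtain ⟨E', hE'⟩ := h.contract hw hu huw hE (fun c q _ hwc _ => hsu.trans hwc)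
      obtain ⟨S'', E'', h1, h2, h3, h4⟩ := ih hE' (by rw [Finset.card_erase_of_mem hw]; omega)
      refine ⟨S'', E'', h1, h2.trans (Finset.erase_subset _ _), fun x hx => ?_, h4⟩
      by_cases hxw : x = w
      · subst hxw
        obtain ⟨y, hy, hyu⟩ := h3 u (Finset.mem_erase.mpr ⟨huw, hu⟩)
        exact ⟨y, hy, hyu.trans hsu⟩
      · exact h3 x (Finset.mem_erase.mpr ⟨hxw, hx⟩)

/-- The degrees sum to at most `2 * E.card < 2 * S.card`, so some vertex meets at most one pair;
connectivity gives it at least one. -/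
lemma exists_leaf [DecidableEq V] (h : IsConnecting s S E) (hS : 2 ≤ S.card) :
    ∃ v ∈ S, ∃ u ∈ S, u ≠ v ∧ ((v, u) ∈ E ∨ (u, v) ∈ E) ∧
      ∀ q, ((v, q) ∈ E ∨ (q, v) ∈ E) → q = u := by
  let D : V → Finset (V × V) := fun v => E.filter fun e => e.1 = v ∨ e.2 = v
  have hsum : ∑ v ∈ S, (D v).card ≤ 2 * E.card := by
    have h1 : ∑ v ∈ S, (D v).card = ∑ e ∈ E, (S.filter fun v => e.1 = v ∨ e.2 = v).card := by
      simp only [D, Finset.card_filter]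
      rw [Finset.sum_comm]
    rw [h1, mul_comm, ← smul_eq_mul]
    refine Finset.sum_le_card_nsmul _ _ _ fun e _ => ?_
    have : (S.filter fun v => e.1 = v ∨ e.2 = v) ⊆ {e.1, e.2} := by
      intro v hv
      rcases (Finset.mem_filter.mp hv).2 with h | h <;> simp [h]
    exact (Finset.card_le_card this).trans Finset.card_le_two
  obtain ⟨v, hv, hv1⟩ : ∃ v ∈ S, (D v).card ≤ 1 := by
    by_contra! hcon
    have := Finset.card_nsmul_le_sum S (fun v => (D v).card) 2 fun v hv => hcon v hv
    have h2 := h.card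
    rw [smul_eq_mul] at this
    omega
  obtain ⟨x, hx, hxv⟩ : ∃ x ∈ S, x ≠ v := Finset.exists_mem_ne (by omega) v
  obtain ⟨⟨u, huv, hr⟩, -⟩ := (h.conn v hv x hx).exists_rel_of_ne hxv.symm
  have hE : (v, u) ∈ E ∨ (u, v) ∈ E := hr.imp And.left And.left
  have hu : u ∈ S := by
    rcases hE with h' | h'
    · exact (h.mem _ h').2
    · exact (h.mem _ h').1
  refine ⟨v, hv, u, hu, huv, hE, fun q hq => ?_⟩
  rw [Finset.card_le_one] at hv1
  have key : ∀ e ∈ E, (e.1 = v ∨ e.2 = v) → ∀ e' ∈ E, (e'.1 = v ∨ e'.2 = v) → e = e' :=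
    fun e he h1 e' he' h2 => hv1 e (Finset.mem_filter.mpr ⟨he, h1⟩) e' (Finset.mem_filter.mpr ⟨he', h2⟩)
  rcases hE with hE | hE <;> rcases hq with hq | hq
  · exact (congrArg Prod.snd (key _ hE (.inl rfl) _ hq (.inl rfl))).symm
  · exact absurd (congrArg Prod.snd (key _ hE (.inl rfl) _ hq (.inr rfl))) huv
  · exact absurd (congrArg Prod.fst (key _ hE (.inr rfl) _ hq (.inl rfl))) huv
  · exact (congrArg Prod.fst (key _ hE (.inr rfl) _ hq (.inr rfl))).symm

/-- The elements can be listed so that each one, from the second on, has an earlier parent whose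
label is bounded by the supremum of its label and any earlier label. -/
lemma exists_order [DecidableEq V] (h : IsConnecting s S E) {m : ℕ} (hm : S.card = m + 1) :
    ∃ (v : ℕ → V) (par : ℕ → ℕ), (∀ x, x ∈ S ↔ ∃ i ≤ m, v i = x) ∧
      ∀ j < m, par j ≤ j ∧ ∀ i ≤ j, s (v (par j)) ≤ s (v i) ⊔ s (v (j + 1)) := by
  induction m generalizing S E with
  | zero =>
    obtain ⟨x, rfl⟩ := Finset.card_eq_one.mp hm
    exact ⟨fun _ => x, fun _ => 0, fun y => by simp [eq_comm], by simp⟩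
  | succ m ih =>
    obtain ⟨w, hw, u, hu, huw, hE, huniq⟩ := h.exists_leaf (by omega)
    obtain ⟨E', hE'⟩ := h.contract hw hu huw hE (fun c q hq _ hc => by rwa [← huniq q hq])
    obtain ⟨v, par, hv, hpar⟩ := ih hE' (by rw [Finset.card_erase_of_mem hw]; omega)
    obtain ⟨p, hp, hpu⟩ := (hv u).mp (Finset.mem_erase.mpr ⟨huw, hu⟩)
    -- The leaf comes last, with its only neighbour as parent. A chain from any earlier vertex must
    -- end in that edge, which gives the bound on the parent.
    refine ⟨fun i => if i = m + 1 then w else v i, fun j => if j = m then p else par j, ?_, ?_⟩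
    · intro x
      constructor
      · intro hx
        by_cases hxw : x = w
        · exact ⟨m + 1, le_rfl, by simp [hxw]⟩
        · obtain ⟨i, hi, hix⟩ := (hv x).mp (Finset.mem_erase.mpr ⟨hxw, hx⟩)
          exact ⟨i, by omega, by simp only [show i ≠ m + 1 by omega, if_false]; exact hix⟩
      · rintro ⟨i, hi, rfl⟩
        dsimp only
        split_ifs with him
        · exact hw
        · exact Finset.mem_of_mem_erase ((hv _).mpr ⟨i, by omega, rfl⟩)
    · intro j hj
      by_cases hjm : j = m
      · subst hjm
        refine ⟨by simpa using hp, fun i hi => ?_⟩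
        have h1 : i ≠ j + 1 := by omega
        have h2 : p ≠ j + 1 := by omega
        simp only [if_true, h1, h2, if_false, hpu]
        have hvi := Finset.mem_erase.mp ((hv (v i)).mpr ⟨i, hi, rfl⟩)
        obtain ⟨-, q, hq, hr⟩ := (h.conn (v i) hvi.2 w hw).exists_rel_of_ne hvi.1
        have hqu := huniq q (hr.imp And.left And.left)
        subst hqu
        rcases hr with hr | hr
        · exact le_sup_right.trans hr.2
        · exact le_sup_left.trans hr.2
      · obtain ⟨h1, h2⟩ := hpar j (by omega)
        simp only [hjm, if_false]
        refine ⟨h1, fun i hi => ?_⟩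
        simp only [show par j ≠ m + 1 by omega, show i ≠ m + 1 by omega,
          show j + 1 ≠ m + 1 by omega, if_false]
        exact h2 i hi

end IsConnecting

end TreeOrder

/-! ### Exponents of one variable along the tree -/

section ExponentTree

/-- Data recording, for one variable, its exponents `a` (zero or one) in the squarefree generators
of an ordered tree, its exponents `u` and `w` in the entries of the edges, and its exponents `b` in
the maximal minors. -/
structure IsExponentTree (m : ℕ) (par a u w b : ℕ → ℕ) : Prop where
  par_le : ∀ j < m, par j ≤ j
  le_one : ∀ i, a i ≤ 1
  le_max : ∀ j < m, ∀ i ≤ j, a (par j) ≤ max (a i) (a (j + 1))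
  exists_zero : ∃ i ≤ m, a i = 0
  up : ∀ j < m, u j = 0 ↔ a (par j) ≤ a (j + 1)
  down : ∀ j < m, w j = 0 ↔ a (j + 1) ≤ a (par j)
  base : b 0 = ∑ j ∈ Finset.range m, u j
  step : ∀ j < m, b (j + 1) = b (par j) + w j - u j

namespace IsExponentTree

variable {m : ℕ} {par a u w b : ℕ → ℕ}

/-- Along edge `j` the exponent falls from one to zero, and then the parent inequality forces a one
at every earlier index: `j + 1` is the first zero, so the dropping edge is unique. -/
lemma drop (h : IsExponentTree m par a u w b) {j : ℕ} (hj : j < m) (hu : u j ≠ 0) :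
    (∀ i ≤ j, a i = 1) ∧ a (j + 1) = 0 := by
  have h1 := mt (h.up j hj).mpr hu
  have h2 := h.le_one (par j)
  have h3 : a (j + 1) = 0 := by omega
  refine ⟨fun i hi => ?_, h3⟩
  have h4 := h.le_max j hj i hi
  have h5 := h.le_one i
  omega

lemma base_eq (h : IsExponentTree m par a u w b) {j : ℕ} (hj : j < m) (hu : u j ≠ 0) :
    b 0 = u j := by
  rw [h.base]
  refine Finset.sum_eq_single j (fun l hl hlj => ?_) (fun hj' => absurd (Finset.mem_range.mpr hj) hj')
  by_contra hul
  rw [Finset.mem_range] at hl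
  have h1 := h.drop hj hu
  have h2 := h.drop hl hul
  rcases lt_or_gt_of_ne hlj with hlt | hlt
  · have := h1.1 (l + 1) hlt; omega
  · have := h2.1 (j + 1) hlt; omega

/-- The first zero is entered by a drop, because its parent comes earlier and hence has exponent
one. -/
lemma exists_drop (h : IsExponentTree m par a u w b) (h0 : a 0 = 1) : ∃ j < m, u j ≠ 0 := by
  classical
  have hex := h.exists_zero
  have ht := Nat.find_spec hex
  have hpos : 0 < Nat.find hex := by
    rcases Nat.eq_zero_or_pos (Nat.find hex) with h1 | h1
    · rw [h1] at ht; omega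
    · exact h1
  obtain ⟨j, hj⟩ := Nat.exists_eq_add_one.mpr hpos
  rw [hj] at ht
  refine ⟨j, ht.1, fun hu => ?_⟩
  have h1 := (h.up j ht.1).mp hu
  have h2 := Nat.find_min hex (m := par j) (by have := h.par_le j ht.1; omega)
  have h3 := h.par_le j ht.1
  have h4 : a (par j) ≠ 0 := fun h4 => h2 ⟨by omega, h4⟩
  omega

/-- The two claims need a joint induction: up to the drop `b` is constantly `b 0 = u j`, so
subtracting `u j` lands exactly on zero. -/
lemma main (h : IsExponentTree m par a u w b) (i : ℕ) (hi : i ≤ m) :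
    (b i = 0 ↔ a i = 0) ∧ ((∀ l ≤ i, a l = 1) → b i = b 0) := by
  induction i using Nat.strong_induction_on with
  | _ i ih =>
    cases i with
    | zero =>
      refine ⟨?_, fun _ => rfl⟩
      have := h.le_one 0
      by_cases h0 : a 0 = 0
      · refine iff_of_true ?_ h0
        rw [h.base]
        refine Finset.sum_eq_zero fun j hj => ?_
        by_contra hu
        have := (h.drop (Finset.mem_range.mp hj) hu).1 0 (Nat.zero_le _)
        omega
      · obtain ⟨j, hj, hu⟩ := h.exists_drop (by omega)
        rw [h.base_eq hj hu]
        exact iff_of_false hu h0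
    | succ j =>
      have hj : j < m := hi
      have hp := h.par_le j hj
      have ihp := ih (par j) (by omega) (by omega)
      have hs := h.step j hj
      have ha1 := h.le_one (par j)
      have ha2 := h.le_one (j + 1)
      by_cases hu : u j = 0
      · have h1 := (h.up j hj).mp hu
        by_cases hw : w j = 0
        · have h2 := (h.down j hj).mp hw
          have h3 : a (par j) = a (j + 1) := le_antisymm h1 h2
          have h4 : b (j + 1) = b (par j) := by omega
          rw [h4, ← h3]
          exact ⟨ihp.1, fun hl => ihp.2 fun l hl' => hl l (by omega)⟩
        · have h2 := mt (h.down j hj).mpr hw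
          have h3 : a (par j) = 0 := by omega
          have h4 := ihp.1.mpr h3
          refine ⟨iff_of_false (by omega) (by omega), fun hl => ?_⟩
          have := hl (par j) (by omega)
          omega
      · obtain ⟨h1, h2⟩ := h.drop hj hu
        have h3 := ihp.2 fun l hl => h1 l (by omega)
        rw [h.base_eq hj hu] at h3
        have h4 := (h.down j hj).mpr (by omega)
        refine ⟨iff_of_true (by omega) h2, fun hl => ?_⟩
        have := hl (j + 1) le_rfl
        omega

lemma eq_zero_iff (h : IsExponentTree m par a u w b) {i : ℕ} (hi : i ≤ m) : b i = 0 ↔ a i = 0 :=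
  (h.main i hi).1

lemma eq_base (h : IsExponentTree m par a u w b) {i : ℕ} (hi : i ≤ m) (hl : ∀ l ≤ i, a l = 1) :
    b i = b 0 := (h.main i hi).2 hl

lemma eq_or_drop (h : IsExponentTree m par a u w b) {j : ℕ} (hj : j < m) (hb : b (par j) ≠ 0) :
    b (j + 1) = b (par j) ∨ (∀ i ≤ j, a i = 1) ∧ a (j + 1) = 0 := by
  by_cases hu : u j = 0
  · left
    have h1 := (h.up j hj).mp hu
    have h2 := mt (h.eq_zero_iff ((h.par_le j hj).trans hj.le)).mpr hb
    have h3 := (h.down j hj).mpr (by have := h.le_one (j + 1); omega)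
    have := h.step j hj
    omega
  · exact .inr (h.drop hj hu)

/-- The subtraction in `step` never truncates: at the drop `b (par j) = u j`, elsewhere `u j = 0`.
-/
lemma add_eq (h : IsExponentTree m par a u w b) {j : ℕ} (hj : j < m) :
    b (j + 1) + u j = b (par j) + w j := by
  have hs := h.step j hj
  by_cases hu : u j = 0
  · omega
  · obtain ⟨h1, h2⟩ := h.drop hj hu
    have hp := h.par_le j hj
    have h3 := h.eq_base (hp.trans hj.le) fun l hl => h1 l (by omega)
    rw [h.base_eq hj hu] at h3
    omega

/-- A non-zero parent value is copied to the child unless the edge is the drop, before which `b` is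
constant. -/
lemma minor_le_max (h : IsExponentTree m par a u w b) {j : ℕ} (hj : j < m) {i : ℕ} (hi : i ≤ j) :
    b (par j) ≤ max (b i) (b (j + 1)) := by
  by_cases hb : b (par j) = 0
  · omega
  · have hp := h.par_le j hj
    rcases h.eq_or_drop hj hb with h1 | ⟨h1, -⟩
    · omega
    · have h2 := h.eq_base (hp.trans hj.le) fun l hl => h1 l (by omega)
      have h3 := h.eq_base (hi.trans hj.le) fun l hl => h1 l (by omega)
      omega

lemma minor_eq (h : IsExponentTree m par a u w b) (hu : ∀ j < m, u j = a (par j) - a (j + 1))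
    (hw : ∀ j < m, w j = a (j + 1) - a (par j)) {i : ℕ} (hi : i ≤ m) : b i = a i := by
  induction i using Nat.strong_induction_on with
  | _ i ih =>
    cases i with
    | zero =>
      by_cases h0 : a 0 = 0
      · rw [h0, h.eq_zero_iff hi, h0]
      · have := h.le_one 0
        obtain ⟨j, hj, hu'⟩ := h.exists_drop (by omega)
        rw [h.base_eq hj hu']
        have := h.le_one (par j)
        have := hu j hj
        omega
    | succ j =>
      have h1 := h.add_eq hi
      have hp := h.par_le j hi
      have h2 := ih (par j) (by omega) (by omega)
      have := hu j hi
      have := hw j hi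
      omega

/-- For two variables such that every generator is divisible by one of them, the exponents of the
maximal minors dominate one of two corner exponents. -/
lemma exists_corners {a' u' w' b' : ℕ → ℕ} (h : IsExponentTree m par a u w b)
    (h' : IsExponentTree m par a' u' w' b') (hne : ∀ i ≤ m, a i = 0 → a' i ≠ 0) :
    ∃ s ≤ m, ∃ t ≤ m, b s = 0 ∧ b' t = 0 ∧ ∀ i ≤ m, b t ≤ b i ∨ b' s ≤ b' i := by
  classical
  -- Take the first zeros `s` and `t`, say with `s < t`. Before `t`, `b'` is constant; after `t`
  -- neither variable can drop any more, so each vertex inherits from its parent equality with one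
  -- of the two corner values.
  suffices H : ∀ {a u w b a' u' w' b' : ℕ → ℕ} (h : IsExponentTree m par a u w b)
      (h' : IsExponentTree m par a' u' w' b') (hne : ∀ i ≤ m, a i = 0 → a' i ≠ 0) (s t : ℕ)
      (hs : s ≤ m) (ht : t ≤ m) (has : a s = 0) (hat : a' t = 0) (hmin : ∀ i < t, a' i ≠ 0)
      (hst : s < t) (i : ℕ), i ≤ m → b t = b i ∨ b' s = b' i by
    have hx := Nat.find_spec h.exists_zero
    have hy := Nat.find_spec h'.exists_zero
    have hxm : ∀ i < Nat.find h.exists_zero, a i ≠ 0 := fun i hi h0 =>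
      Nat.find_min h.exists_zero hi ⟨by omega, h0⟩
    have hym : ∀ i < Nat.find h'.exists_zero, a' i ≠ 0 := fun i hi h0 =>
      Nat.find_min h'.exists_zero hi ⟨by omega, h0⟩
    refine ⟨_, hx.1, _, hy.1, (h.eq_zero_iff hx.1).mpr hx.2, (h'.eq_zero_iff hy.1).mpr hy.2,
      fun i hi => ?_⟩
    rcases lt_trichotomy (Nat.find h.exists_zero) (Nat.find h'.exists_zero) with hlt | heq | hlt
    · exact (H h h' hne _ _ hx.1 hy.1 hx.2 hy.2 hym hlt i hi).imp le_of_eq le_of_eq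
    · exact absurd (heq ▸ hy.2) (hne _ hx.1 hx.2)
    · exact (H h' h (fun i hi h0 h1 => hne i hi h1 h0) _ _ hy.1 hx.1 hy.2 hx.2 hxm hlt i hi).symm.imp
        le_of_eq le_of_eq
  intro a u w b a' u' w' b' h h' hne s t hs ht has hat hmin hst i
  have hone : ∀ l < t, a' l = 1 := fun l hl => by
    have := h'.le_one l
    have := hmin l hl
    omega
  have hbt : b t ≠ 0 := fun h0 => hne t ht ((h.eq_zero_iff ht).mp h0) hat
  have hbs : b' s ≠ 0 := fun h0 => hne s hs has ((h'.eq_zero_iff hs).mp h0)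
  induction i using Nat.strong_induction_on with
  | _ i ih =>
    intro hi
    rcases lt_trichotomy i t with hit | hit | hit
    · right
      rw [h'.eq_base hs fun l hl => hone l (by omega), h'.eq_base hi fun l hl => hone l (by omega)]
    · left; rw [hit]
    · cases i with
      | zero => omega
      | succ j =>
        have hp := h.par_le j hi
        rcases ih (par j) (by omega) (by omega) with h1 | h1
        · left
          rcases h.eq_or_drop hi (by omega) with h2 | ⟨h2, -⟩
          · omega
          · have := h2 s (by omega); omega
        · right
          rcases h'.eq_or_drop hi (by omega) with h2 | ⟨h2, -⟩
          · omega
          · have := h2 t (by omega); omega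

end IsExponentTree

end ExponentTree

/-! ### The matrix of a tree and its maximal minors -/

section TreeMatrix

open MvPolynomial

/-- The recursion along a parent function: the value at `j + 1` is computed from the value at the
parent of `j`. -/
def treeRec {α : Type*} (z : α) (F : ℕ → α → α) (par : ℕ → ℕ) : ℕ → α
  | 0 => z
  -- The minimum only secures termination.
  | j + 1 => F j (treeRec z F par (min (par j) j))
decreasing_by omega

lemma treeRec_zero {α : Type*} (z : α) (F : ℕ → α → α) (par : ℕ → ℕ) : treeRec z F par 0 = z := by
  rw [treeRec]

lemma treeRec_succ {α : Type*} (z : α) (F : ℕ → α → α) (par : ℕ → ℕ) {j : ℕ} (hj : par j ≤ j) :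
    treeRec z F par (j + 1) = F j (treeRec z F par (par j)) := by
  rw [treeRec, min_eq_left hj]

variable {σ k : Type*} [Field k]

variable (k) in
/-- The matrix whose column `j` has the monomial with exponent `u j` in row `j + 1` and the negative
of the monomial with exponent `w j` in row `par j`. -/
noncomputable def treeMatrix (m : ℕ) (par : ℕ → ℕ) (u w : ℕ → σ →₀ ℕ) :
    Matrix (Fin (m + 1)) (Fin m) (MvPolynomial σ k) :=
  fun i j => (if (i : ℕ) = j + 1 then monomial (u j) 1 else 0) -
    (if (i : ℕ) = par j then monomial (w j) 1 else 0)

variable {m : ℕ} {par : ℕ → ℕ} {u w b : ℕ → σ →₀ ℕ}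

lemma treeMatrix_succ (hpar : ∀ j < m, par j ≤ j) {i : Fin (m + 1)} {j : Fin m}
    (hi : (i : ℕ) = j + 1) : treeMatrix k m par u w i j = monomial (u j) 1 := by
  have := hpar j j.2
  rw [treeMatrix, if_pos hi, if_neg (by omega), sub_zero]

lemma treeMatrix_par (hpar : ∀ j < m, par j ≤ j) {i : Fin (m + 1)} {j : Fin m}
    (hi : (i : ℕ) = par j) : treeMatrix k m par u w i j = -monomial (w j) 1 := by
  have := hpar j j.2
  rw [treeMatrix, if_neg (by omega), if_pos hi, zero_sub]

lemma treeMatrix_of_ne {i : Fin (m + 1)} {j : Fin m} (h1 : (i : ℕ) ≠ j + 1) (h2 : (i : ℕ) ≠ par j) :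
    treeMatrix k m par u w i j = 0 := by
  rw [treeMatrix, if_neg h1, if_neg h2, sub_zero]

lemma sum_treeMatrix_mul (hpar : ∀ j < m, par j ≤ j) (g : ℕ → MvPolynomial σ k) (j : Fin m) :
    ∑ i : Fin (m + 1), treeMatrix k m par u w i j * g i =
      monomial (u j) 1 * g (j + 1) - monomial (w j) 1 * g (par j) := by
  simp only [treeMatrix, sub_mul, ite_mul, zero_mul, Finset.sum_sub_distrib]
  congr 1
  · rw [Finset.sum_eq_single j.succ]
    · simp
    · intro i _ hi
      rw [if_neg]
      exact fun h => hi (Fin.ext (by simpa using h))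
    · simp
  · have := hpar j j.2
    rw [Finset.sum_eq_single (⟨par j, by omega⟩ : Fin (m + 1))]
    · simp
    · intro i _ hi
      rw [if_neg]
      exact fun h => hi (Fin.ext h)
    · simp

/-- Laplace expansion of the square matrix in which column `j` is repeated. -/
lemma sum_mul_signedMaximalMinor {A : Type*} [CommRing A] {m : ℕ}
    (φ : Matrix (Fin (m + 1)) (Fin m) A) (j : Fin m) :
    ∑ i, φ i j * signedMaximalMinor φ i = 0 := by
  let M : Matrix (Fin (m + 1)) (Fin (m + 1)) A := fun i => Fin.cons (φ i j) (φ i)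
  have h0 : M.det = 0 := Matrix.det_zero_of_column_eq (Fin.succ_ne_zero j).symm fun i => by simp [M]
  rw [Matrix.det_succ_column_zero] at h0
  rw [← h0]
  refine Finset.sum_congr rfl fun i _ => ?_
  have : M.submatrix i.succAbove Fin.succ = φ.submatrix i.succAbove id := by
    ext p q; rfl
  rw [this, signedMaximalMinor]
  simp only [M, Fin.cons_zero]
  ring

/-- With row zero deleted, the entries in rows `j + 1` form the diagonal and `par j ≤ j` keeps the
others above it. -/
lemma signedMaximalMinor_treeMatrix_zero (hpar : ∀ j < m, par j ≤ j) :
    signedMaximalMinor (treeMatrix k m par u w) 0 = monomial (∑ j ∈ Finset.range m, u j) 1 := by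
  have htri : ((treeMatrix k m par u w).submatrix (Fin.succAbove 0) id).BlockTriangular id := by
    intro i j hij
    have hij' : (j : ℕ) < i := hij
    have := hpar j j.2
    rw [Matrix.submatrix_apply]
    refine treeMatrix_of_ne ?_ ?_ <;> simp <;> omega
  rw [signedMaximalMinor, Matrix.det_of_isUpperTriangular htri, Fin.val_zero, pow_zero, one_mul,
    Finset.sum_range, monomial_sum_one]
  exact Finset.prod_congr rfl fun j _ => treeMatrix_succ hpar (by simp)

/-- Starting from the triangular minor, the relation given by column `j` determines minor `j + 1`
from that of its parent, signs included, by cancelling a monomial. -/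
lemma signedMaximalMinor_treeMatrix (hpar : ∀ j < m, par j ≤ j)
    (h0 : b 0 = ∑ j ∈ Finset.range m, u j) (hb : ∀ j < m, b (j + 1) + u j = b (par j) + w j)
    (i : Fin (m + 1)) :
    signedMaximalMinor (treeMatrix k m par u w) i = monomial (b i) 1 := by
  let g : ℕ → MvPolynomial σ k := fun i =>
    if h : i < m + 1 then signedMaximalMinor (treeMatrix k m par u w) ⟨i, h⟩ else 0
  have hg : ∀ i : Fin (m + 1), g i = signedMaximalMinor (treeMatrix k m par u w) i := fun i => by
    simp only [g]; rw [dif_pos i.2]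
  suffices H : ∀ i ≤ m, g i = monomial (b i) 1 by
    rw [← hg]; exact H i (by omega)
  intro i
  induction i using Nat.strong_induction_on with
  | _ i ih =>
    intro hi
    cases i with
    | zero =>
      rw [h0, ← signedMaximalMinor_treeMatrix_zero hpar]
      exact hg 0
    | succ j =>
      have h1 := sum_mul_signedMaximalMinor (treeMatrix k m par u w) ⟨j, hi⟩
      simp only [← hg] at h1
      rw [sum_treeMatrix_mul hpar] at h1
      have hp := hpar j hi
      simp only at h1
      rw [ih (par j) (by omega) (by omega), sub_eq_zero, monomial_mul, mul_one,
        add_comm (w _), ← hb j hi, add_comm (b _)] at h1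
      have h2 : monomial (u j + b (j + 1)) (1 : k) = monomial (u j) 1 * monomial (b (j + 1)) 1 := by
        rw [monomial_mul, mul_one]
      rw [h2] at h1
      exact mul_left_cancel₀ (by simp) h1

end TreeMatrix

/-! ### Exactness and column homogenization -/

section TreeMatrix

open MvPolynomial

variable {σ k : Type*} [Field k] {m : ℕ} {par : ℕ → ℕ} {a u w u' w' b : ℕ → σ →₀ ℕ}

/-- The colon ideal is principal: by the parent inequality, `b p - b (j + 1)` divides every
generator `b i - b (j + 1)`. Exactness and depth both rest on this. -/
lemma mul_monomial_mem_iff_of_le_sup {j p : ℕ} (hp : p ≤ j)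
    (hle : ∀ i ≤ j, b p ≤ b i ⊔ b (j + 1)) {f : MvPolynomial σ k} :
    f * monomial (b (j + 1)) 1 ∈ monomialIdeal k (b '' Set.Iic j) ↔
      f ∈ Ideal.span {monomial (b p - b (j + 1)) (1 : k)} := by
  constructor
  · intro hf
    have h1 := mem_monomialIdeal_of_mul_monomial_mem hf
    refine (Ideal.span_le.mpr ?_ : monomialIdeal k _ ≤ _) h1
    rintro _ ⟨_, ⟨_, ⟨i, hi, rfl⟩, rfl⟩, rfl⟩
    rw [SetLike.mem_coe, Ideal.mem_span_singleton]
    refine ⟨monomial ((b i - b (j + 1)) - (b p - b (j + 1))) 1, ?_⟩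
    rw [monomial_mul, one_mul, add_tsub_cancel_of_le]
    intro x
    have := hle i hi x
    simp only [Finsupp.sup_apply, Finsupp.tsub_apply] at this ⊢
    omega
  · intro hf
    obtain ⟨g, rfl⟩ := Ideal.mem_span_singleton'.mp hf
    rw [mul_assoc, monomial_tsub_mul]
    refine Ideal.mul_mem_left _ _ (monomial_mem_monomialIdeal.mpr ⟨_, ⟨p, hp, rfl⟩, le_sup_right⟩)

lemma maximalMinorsIdeal_treeMatrix (hpar : ∀ j < m, par j ≤ j)
    (h0 : b 0 = ∑ j ∈ Finset.range m, u j) (hb : ∀ j < m, b (j + 1) + u j = b (par j) + w j) :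
    maximalMinorsIdeal (treeMatrix k m par u w) = monomialIdeal k (b '' Set.Iic m) := by
  rw [maximalMinorsIdeal, monomialIdeal]
  congr 1
  ext f
  constructor
  · rintro ⟨i, rfl⟩
    rw [signedMaximalMinor_treeMatrix hpar h0 hb]
    exact ⟨_, ⟨i, Nat.lt_succ_iff.mp i.2, rfl⟩, rfl⟩
  · rintro ⟨_, ⟨i, hi, rfl⟩, rfl⟩
    exact ⟨⟨i, Nat.lt_succ_iff.mpr hi⟩, signedMaximalMinor_treeMatrix hpar h0 hb _⟩

/-- Exactness is by induction on the last non-zero coordinate of a syzygy: it is a multiple of the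
entry with exponent `u j`, so a multiple of column `j` removes it. Minimality comes from the
antichain condition, injectivity from a non-zero minor. -/
lemma isHilbertBurchMatrix_treeMatrix (hpar : ∀ j < m, par j ≤ j)
    (h0 : b 0 = ∑ j ∈ Finset.range m, u j) (hb : ∀ j < m, b (j + 1) + u j = b (par j) + w j)
    (hu : ∀ j < m, u j = b (par j) - b (j + 1))
    (hle : ∀ j < m, ∀ i ≤ j, b (par j) ≤ b i ⊔ b (j + 1))
    (hanti : ∀ i ≤ m, ∀ j ≤ m, b i ≤ b j → i = j) :
    IsHilbertBurchMatrix (treeMatrix k m par u w) (monomialIdeal k (b '' Set.Iic m)) := by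
  have hmin := signedMaximalMinor_treeMatrix (k := k) hpar h0 hb
  refine ⟨maximalMinorsIdeal_treeMatrix hpar h0 hb, fun i hi => ?_, ?_, fun v => ⟨fun hv => ?_, ?_⟩⟩
  · have h1 : monomial (b i) (1 : k) ∈ monomialIdeal k ((fun j : Fin (m + 1) => b j) '' {j | j ≠ i}) := by
      rw [← hmin, monomialIdeal, Set.image_image]
      simpa only [← hmin] using hi
    obtain ⟨_, ⟨j, hj, rfl⟩, hji⟩ := monomial_mem_monomialIdeal.mp h1
    exact hj (Fin.ext (hanti _ (by omega) _ (by omega) hji))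
  · have hdet : ((treeMatrix k m par u w).submatrix (Fin.succAbove 0) id).det ≠ 0 := by
      have h1 := hmin 0
      rw [signedMaximalMinor, Fin.val_zero, pow_zero, one_mul] at h1
      rw [h1]
      simp
    intro c d hcd
    have h2 := Matrix.eq_zero_of_mulVec_eq_zero hdet (v := c - d) (by
      rw [Matrix.mulVec_sub, sub_eq_zero]
      ext1 i
      exact congrFun hcd (Fin.succAbove 0 i))
    exact sub_eq_zero.mp h2
  · suffices H : ∀ n ≤ m, ∀ v : Fin (m + 1) → MvPolynomial σ k, (∀ i : Fin (m + 1), n < (i : ℕ) → v i = 0) →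
        ∑ i, v i * signedMaximalMinor (treeMatrix k m par u w) i = 0 →
        ∃ c, (treeMatrix k m par u w).mulVec c = v from
      H m le_rfl v (fun i hi => absurd i.2 (by omega)) hv
    intro n
    induction n with
    | zero =>
      intro _ v hv h1
      refine ⟨0, ?_⟩
      rw [Matrix.mulVec_zero]
      rw [Finset.sum_eq_single 0 (fun i _ hi => by
        rw [hv i (Nat.pos_of_ne_zero fun h => hi (Fin.ext h)), zero_mul]) (by simp), hmin] at h1
      ext1 i
      rcases eq_or_ne i 0 with rfl | hi
      · exact ((mul_eq_zero.mp h1).resolve_right (by simp)).symm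
      · exact (hv i (Nat.pos_of_ne_zero fun h => hi (Fin.ext h))).symm
    | succ j ih =>
      intro hj v hv h1
      let j' : Fin m := ⟨j, hj⟩
      have h2 : v j'.succ * monomial (b (j + 1)) 1 ∈ monomialIdeal k (b '' Set.Iic j) := by
        rw [← Finset.add_sum_erase _ _ (Finset.mem_univ j'.succ), hmin] at h1
        rw [show b (j + 1) = b (j'.succ : Fin (m + 1)) from rfl, eq_neg_of_add_eq_zero_left h1]
        refine neg_mem (sum_mem fun i hi => ?_)
        by_cases hij : j + 1 < (i : ℕ)
        · rw [hv i hij, zero_mul]; exact zero_mem _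
        · have hne : (i : ℕ) ≠ j + 1 := fun h => (Finset.mem_erase.mp hi).1 (Fin.ext h)
          rw [hmin]
          exact Ideal.mul_mem_left _ _ (monomial_mem_monomialIdeal.mpr
            ⟨_, ⟨i, by rw [Set.mem_Iic]; omega, rfl⟩, le_rfl⟩)
      rw [mul_monomial_mem_iff_of_le_sup (hpar j hj) (hle j hj), ← hu j hj] at h2
      obtain ⟨h, hh⟩ := Ideal.mem_span_singleton'.mp h2
      have hcol : ∀ i, (treeMatrix k m par u w).mulVec (Pi.single j' h) i =
          treeMatrix k m par u w i j' * h := fun i => by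
        rw [Matrix.mulVec_single]; simp
      have h3 : ∀ i : Fin (m + 1), j < (i : ℕ) →
          (v - (treeMatrix k m par u w).mulVec (Pi.single j' h)) i = 0 := fun i hi => by
        rw [Pi.sub_apply, hcol]
        rcases eq_or_ne (i : ℕ) (j + 1) with hij | hij
        · rw [treeMatrix_succ hpar (j := j') hij, show i = j'.succ from Fin.ext hij, ← hh]
          ring
        · have := hpar j hj
          rw [hv i (by omega), treeMatrix_of_ne (j := j') hij (by simp only [j']; omega), zero_mul,
            sub_zero]
      obtain ⟨c, hc⟩ := ih (by omega) _ h3 (by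
        simp only [Pi.sub_apply, sub_mul, Finset.sum_sub_distrib, h1, hcol]
        simp only [mul_right_comm _ h, ← Finset.sum_mul, sum_mul_signedMaximalMinor]
        simp)
      exact ⟨c + Pi.single j' h, by rw [Matrix.mulVec_add, hc, sub_add_cancel]⟩
  · rintro ⟨c, rfl⟩
    simp only [Matrix.mulVec, dotProduct, Finset.sum_mul]
    rw [Finset.sum_comm]
    simp only [mul_right_comm _ (c _), ← Finset.sum_mul, sum_mul_signedMaximalMinor, zero_mul,
      Finset.sum_const_zero]

lemma hasTwoMonomialColumns_treeMatrix (hpar : ∀ j < m, par j ≤ j) :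
    HasTwoMonomialColumns (treeMatrix k m par u w) := by
  intro j
  have hp := hpar j j.2
  refine ⟨?_, fun i => ?_⟩
  · have : {i | treeMatrix k m par u w i j ≠ 0} = {j.succ, ⟨par j, by omega⟩} := by
      ext i
      simp only [Set.mem_ofPred_eq, Set.mem_insert_iff, Set.mem_singleton_iff]
      constructor
      · intro hi
        by_contra! h
        exact hi (treeMatrix_of_ne (fun h1 => h.1 (Fin.ext h1)) fun h1 => h.2 (Fin.ext h1))
      · rintro (rfl | rfl)
        · rw [treeMatrix_succ hpar (by simp)]; simp
        · rw [treeMatrix_par hpar rfl]; simp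
    rw [this, Set.ncard_pair]
    intro h
    have := congrArg Fin.val h
    simp at this
    omega
  · by_cases h1 : (i : ℕ) = j + 1
    · exact ⟨_, _, treeMatrix_succ hpar h1⟩
    · by_cases h2 : (i : ℕ) = par j
      · exact ⟨w j, -1, by rw [treeMatrix_par hpar h2, map_neg]⟩
      · exact ⟨0, 0, by rw [treeMatrix_of_ne h1 h2, map_zero]⟩

lemma sup_totalDegree_treeMatrix (hpar : ∀ j < m, par j ≤ j) (j : Fin m) :
    (Finset.univ.sup fun l => (treeMatrix k m par u w l j).totalDegree) =
      max (u j).degree (w j).degree := by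
  have hp := hpar j j.2
  apply le_antisymm
  · refine Finset.sup_le fun i _ => ?_
    by_cases h1 : (i : ℕ) = j + 1
    · rw [treeMatrix_succ hpar h1, totalDegree_monomial _ one_ne_zero]
      exact le_max_left _ _
    · by_cases h2 : (i : ℕ) = par j
      · rw [treeMatrix_par hpar h2, totalDegree_neg, totalDegree_monomial _ one_ne_zero]
        exact le_max_right _ _
      · rw [treeMatrix_of_ne h1 h2, totalDegree_zero]
        exact Nat.zero_le _
  · refine max_le ?_ ?_
    · refine le_trans ?_ (Finset.le_sup (Finset.mem_univ j.succ))
      rw [treeMatrix_succ hpar (by simp), totalDegree_monomial _ one_ne_zero]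
      exact le_rfl
    · refine le_trans ?_ (Finset.le_sup (Finset.mem_univ (⟨par j, by omega⟩ : Fin (m + 1))))
      rw [treeMatrix_par hpar rfl, totalDegree_neg, totalDegree_monomial _ one_ne_zero]
      exact le_rfl

lemma isColumnHomogenization_treeMatrix (hpar : ∀ j < m, par j ≤ j)
    (hu : ∀ j < m, u j ≤ u' j ∧ (u' j).support = (u j).support ∧
      (u' j).degree = max (u j).degree (w j).degree)
    (hw : ∀ j < m, w j ≤ w' j ∧ (w' j).support = (w j).support ∧
      (w' j).degree = max (u j).degree (w j).degree) :
    IsColumnHomogenization (treeMatrix k m par u w) (treeMatrix k m par u' w') := by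
  intro i j
  rw [sup_totalDegree_treeMatrix hpar]
  by_cases h1 : (i : ℕ) = j + 1
  · exact .inr ⟨u j, u' j, 1, one_ne_zero, treeMatrix_succ hpar h1, treeMatrix_succ hpar h1, hu j j.2⟩
  · by_cases h2 : (i : ℕ) = par j
    · exact .inr ⟨w j, w' j, -1, by simp, by rw [treeMatrix_par hpar h2, map_neg],
        by rw [treeMatrix_par hpar h2, map_neg], hw j j.2⟩
    · exact .inl ⟨treeMatrix_of_ne h1 h2, treeMatrix_of_ne h1 h2⟩

lemma Finsupp.exists_le_support_eq_degree_eq {e : σ →₀ ℕ} (he : e ≠ 0) {d : ℕ} (hd : e.degree ≤ d) :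
    ∃ e', e ≤ e' ∧ e'.support = e.support ∧ e'.degree = d := by
  classical
  obtain ⟨x, hx⟩ := Finsupp.support_nonempty_iff.mpr he
  -- All of the missing degree goes to one variable that already occurs.
  refine ⟨e + Finsupp.single x (d - e.degree), le_self_add, ?_, ?_⟩
  · ext y
    rcases eq_or_ne y x with rfl | hy
    · simp_all
    · simp [hy]
  · rw [map_add, Finsupp.degree_single]
    omega

end TreeMatrix

/-! ### The ordered tree of the radical -/

section OrderedTree

open MvPolynomial Relation

/-- The connecting pairs of `I` also connect the radicals of its generators, since radicals preserve
divisibility and least common multiples; pruning then leaves the minimal generators. -/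
lemma exists_ordered_tree {k : Type u} [Field k] {r : ℕ} {I : Ideal (MvPolynomial (Fin r) k)}
    (hmon : IsMonomialIdeal I) (hcodim : I.height = 2)
    (hCM : IsCohenMacaulayRing (MvPolynomial (Fin r) k ⧸ I)) :
    ∃ (m : ℕ) (par : ℕ → ℕ) (a : ℕ → Fin r →₀ ℕ), (∀ j < m, par j ≤ j) ∧ (∀ i x, a i x ≤ 1) ∧
      (∀ j < m, ∀ i ≤ j, a (par j) ≤ a i ⊔ a (j + 1)) ∧
      (∀ i ≤ m, ∀ j ≤ m, a i ≤ a j → i = j) ∧ I.radical = monomialIdeal k (a '' Set.Iic m) := by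
  classical
  obtain ⟨S, rfl⟩ := exists_finset_monomialIdeal hmon
  have hS : (S : Set (Fin r →₀ ℕ)) = Set.range ((↑) : S → Fin r →₀ ℕ) := by simp
  rw [hS] at hcodim hCM
  obtain ⟨E, hcard, hconn⟩ := exists_connecting_pairs_of_isCohenMacaulayRing _ hcodim hCM
  let s : S → Fin r →₀ ℕ := fun v => radicalExponent v
  have hE : IsConnecting s Finset.univ E := by
    refine ⟨fun p hp => ⟨Finset.mem_univ _, Finset.mem_univ _⟩, by simpa using hcard,
      fun i _ j _ => (hconn i j).map id fun p q hpq => .inr ⟨hpq.1, ?_⟩⟩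
    have := radicalExponent_mono hpq.2
    rwa [radicalExponent_sup, radicalExponent_sup] at this
  obtain ⟨S', E', hE', -, hcov, hanti⟩ := hE.exists_antichain
  have hpos : 0 < S'.card := by have := hE'.card; omega
  obtain ⟨m, hm⟩ := Nat.exists_eq_add_one.mpr hpos
  obtain ⟨v, par, hv, hpar⟩ := hE'.exists_order hm
  have himg : (Finset.range (m + 1)).image v = S' := by
    ext x
    simp only [Finset.mem_image, Finset.mem_range, hv, Nat.lt_succ_iff]
  have hinj : Set.InjOn v (Finset.range (m + 1)) := by
    rw [← Finset.card_image_iff, himg, hm, Finset.card_range]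
  refine ⟨m, par, fun i => s (v i), fun j hj => (hpar j hj).1, fun i x => min_le_right _ _,
    fun j hj => (hpar j hj).2, fun i hi j hj hij => ?_, ?_⟩
  · exact hinj (by simpa [Nat.lt_succ_iff] using hi) (by simpa [Nat.lt_succ_iff] using hj)
      (hanti _ ((hv _).mpr ⟨i, hi, rfl⟩) _ ((hv _).mpr ⟨j, hj, rfl⟩) hij)
  · rw [radical_monomialIdeal]
    apply le_antisymm
    · rw [monomialIdeal_le_iff]
      rintro _ ⟨e, he, rfl⟩
      obtain ⟨y, hy, hle⟩ := hcov ⟨e, he⟩ (Finset.mem_univ _)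
      obtain ⟨i, hi, rfl⟩ := (hv y).mp hy
      exact monomial_mem_monomialIdeal.mpr ⟨_, ⟨i, hi, rfl⟩, hle⟩
    · rw [monomialIdeal_le_iff]
      rintro _ ⟨i, hi, rfl⟩
      exact monomial_mem_monomialIdeal.mpr ⟨_, ⟨v i, (v i).2, rfl⟩, le_rfl⟩

lemma exists_apply_eq_zero_of_two_le_height {σ k : Type*} [Field k] [Finite σ] {T : Set ℕ}
    {a : ℕ → σ →₀ ℕ} (h : 2 ≤ (monomialIdeal k (a '' T)).height) (x : σ) : ∃ i ∈ T, a i x = 0 := by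
  by_contra! hcon
  have h1 : monomialIdeal k (a '' T) ≤ varIdeal k (({x} : Finset σ) : Set σ) := by
    rw [monomialIdeal_le_varIdeal_iff]
    rintro _ ⟨i, hi, rfl⟩
    exact ⟨x, by simp, hcon i hi⟩
  have h2 := h.trans (Ideal.height_mono h1)
  rw [height_varIdeal, Finset.card_singleton] at h2
  exact absurd h2 (by norm_num)

end OrderedTree

/-! ### Homogenized exponents -/

section Homogenization

variable {σ : Type*} {m : ℕ} {par : ℕ → ℕ} {a : ℕ → σ →₀ ℕ}

lemma isExponentTree_of_squarefree (hpar : ∀ j < m, par j ≤ j) (ha : ∀ i x, a i x ≤ 1)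
    (hle : ∀ j < m, ∀ i ≤ j, a (par j) ≤ a i ⊔ a (j + 1)) (h0 : ∀ x, ∃ i ≤ m, a i x = 0)
    {u w : ℕ → σ →₀ ℕ} (hu : ∀ j < m, (u j).support = (a (par j) - a (j + 1)).support)
    (hw : ∀ j < m, (w j).support = (a (j + 1) - a (par j)).support) (x : σ) :
    IsExponentTree m par (a · x) (u · x) (w · x)
      (treeRec (∑ j ∈ Finset.range m, u j) (fun j c => c + w j - u j) par · x) where
  par_le := hpar
  le_one i := ha i x
  le_max j hj i hi := hle j hj i hi x
  exists_zero := h0 x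
  up j hj := by
    rw [← Finsupp.notMem_support_iff, hu j hj, Finsupp.notMem_support_iff, Finsupp.tsub_apply,
      tsub_eq_zero_iff_le]
  down j hj := by
    rw [← Finsupp.notMem_support_iff, hw j hj, Finsupp.notMem_support_iff, Finsupp.tsub_apply,
      tsub_eq_zero_iff_le]
  base := by rw [treeRec_zero, Finsupp.finsetSum_apply]
  step j hj := by rw [treeRec_succ _ _ _ (hpar j hj)]; rfl

/-- The exponents of a homogenized Hilbert–Burch matrix of an ordered tree. -/
lemma exists_homogenized_tree (hpar : ∀ j < m, par j ≤ j) (ha : ∀ i x, a i x ≤ 1)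
    (hle : ∀ j < m, ∀ i ≤ j, a (par j) ≤ a i ⊔ a (j + 1))
    (hanti : ∀ i ≤ m, ∀ j ≤ m, a i ≤ a j → i = j) (h0 : ∀ x, ∃ i ≤ m, a i x = 0) :
    ∃ u w b : ℕ → σ →₀ ℕ, (∀ x, IsExponentTree m par (a · x) (u · x) (w · x) (b · x)) ∧
      (∃ d, ∀ i ≤ m, (b i).degree = d) ∧
      (∀ j < m, a (par j) - a (j + 1) ≤ u j ∧ (u j).support = (a (par j) - a (j + 1)).support ∧
        (u j).degree = max (a (par j) - a (j + 1)).degree (a (j + 1) - a (par j)).degree) ∧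
      (∀ j < m, a (j + 1) - a (par j) ≤ w j ∧ (w j).support = (a (j + 1) - a (par j)).support ∧
        (w j).degree = max (a (par j) - a (j + 1)).degree (a (j + 1) - a (par j)).degree) := by
  have hu : ∀ j, ∃ e, j < m → a (par j) - a (j + 1) ≤ e ∧
      e.support = (a (par j) - a (j + 1)).support ∧
        e.degree = max (a (par j) - a (j + 1)).degree (a (j + 1) - a (par j)).degree := fun j => by
    by_cases hj : j < m
    · have := hpar j hj
      -- The antichain condition makes the difference non-zero, so some variable is available for
      -- raising.
      obtain ⟨e, he⟩ := Finsupp.exists_le_support_eq_degree_eq (e := a (par j) - a (j + 1))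
        (fun h => by
          have := hanti (par j) (by omega) (j + 1) hj (tsub_eq_zero_iff_le.mp h)
          omega) (le_max_left _ (a (j + 1) - a (par j)).degree)
      exact ⟨e, fun _ => he⟩
    · exact ⟨0, fun h => absurd h hj⟩
  have hw : ∀ j, ∃ e, j < m → a (j + 1) - a (par j) ≤ e ∧
      e.support = (a (j + 1) - a (par j)).support ∧
        e.degree = max (a (par j) - a (j + 1)).degree (a (j + 1) - a (par j)).degree := fun j => by
    by_cases hj : j < m
    · have := hpar j hj
      obtain ⟨e, he⟩ := Finsupp.exists_le_support_eq_degree_eq (e := a (j + 1) - a (par j))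
        (fun h => by
          have := hanti (j + 1) hj (par j) (by omega) (tsub_eq_zero_iff_le.mp h)
          omega) (le_max_right (a (par j) - a (j + 1)).degree _)
      exact ⟨e, fun _ => he⟩
    · exact ⟨0, fun h => absurd h hj⟩
  choose u hu using hu
  choose w hw using hw
  have hT := isExponentTree_of_squarefree hpar ha hle h0 (fun j hj => (hu j hj).2.1)
    (fun j hj => (hw j hj).2.1)
  refine ⟨u, w, _, hT, ⟨(∑ j ∈ Finset.range m, u j).degree, fun i hi => ?_⟩, hu, hw⟩
  · induction i using Nat.strong_induction_on with
    | _ i ih =>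
      cases i with
      | zero => rw [treeRec_zero]
      | succ j =>
        have hp := hpar j hi
        -- The entries of a column have equal degree, so a child has the degree of its parent.
        have h1 := congrArg Finsupp.degree (Finsupp.ext fun x => (hT x).add_eq hi :
          treeRec (∑ j ∈ Finset.range m, u j) (fun j c => c + w j - u j) par (j + 1) + u j =
            treeRec (∑ j ∈ Finset.range m, u j) (fun j c => c + w j - u j) par (par j) + w j)
        rw [map_add, map_add, ih (par j) (by omega) (by omega), (hu j hi).2.2, (hw j hi).2.2] at h1
        omega

end Homogenization

/-! ### Depth of quotients along the tree -/

section Depth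

open IsLocalRing

/-- `Q` is the colon ideal `K : f`; multiplication by `f` gives `0 → A ⧸ Q → A ⧸ K → A ⧸ (K + (f)) →
0`. -/
lemma DepthGE.quotient_sup_span_singleton {A : Type u} [CommRing A] [IsLocalRing A] {K Q : Ideal A}
    {f : A} (hf : ∀ z, z * f ∈ K ↔ z ∈ Q) {n : ℕ} (hQ : DepthGE A (A ⧸ Q) (n + 1))
    (hK : DepthGE A (A ⧸ K) n) : DepthGE A (A ⧸ (K ⊔ Ideal.span {f})) n := by
  have hle : Q ≤ Submodule.comap (LinearMap.mulRight A f) K := fun z hz => (hf z).mpr hz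
  let F : (A ⧸ Q) →ₗ[A] (A ⧸ K) := Submodule.mapQ Q K (LinearMap.mulRight A f) hle
  let G : (A ⧸ K) →ₗ[A] (A ⧸ (K ⊔ Ideal.span {f})) :=
    Submodule.mapQ K (K ⊔ Ideal.span {f}) LinearMap.id le_sup_left
  refine DepthGE.of_exact_right (f := F) (g := G) ?_ ?_ ?_ hQ hK
  · rw [injective_iff_map_eq_zero]
    intro x
    induction x using Submodule.Quotient.induction_on with
    | _ z =>
      intro hz
      refine (Submodule.Quotient.mk_eq_zero Q).mpr ((hf z).mp ?_)
      exact (Submodule.Quotient.mk_eq_zero K).mp hz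
  · intro y
    induction y using Submodule.Quotient.induction_on with
    | _ z =>
      constructor
      · intro hz
        have h1 : z ∈ K ⊔ Ideal.span {f} := (Submodule.Quotient.mk_eq_zero _).mp hz
        obtain ⟨x, hx, y, hy, rfl⟩ := Submodule.mem_sup.mp h1
        obtain ⟨c, rfl⟩ := Ideal.mem_span_singleton'.mp hy
        refine ⟨Submodule.Quotient.mk c, ((Submodule.Quotient.eq K).mpr ?_)⟩
        simpa [LinearMap.mulRight_apply] using hx
      · rintro ⟨x, hx⟩
        rw [← hx]
        induction x using Submodule.Quotient.induction_on with
        | _ c =>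
          refine (Submodule.Quotient.mk_eq_zero _).mpr ?_
          exact le_sup_right (a := K) (Ideal.mul_mem_left _ c (Ideal.mem_span_singleton_self f))
  · intro y
    induction y using Submodule.Quotient.induction_on with
    | _ z => exact ⟨Submodule.Quotient.mk z, rfl⟩

lemma DepthGE.of_surjective {A B : Type u} [CommRing A] [IsLocalRing A] [CommRing B] [Algebra A B]
    (hsurj : Function.Surjective (algebraMap A B)) {I : Ideal A}
    (hker : RingHom.ker (algebraMap A B) = I) {n : ℕ} (h : DepthGE A (A ⧸ I) n) : DepthGE A B n :=
  h.of_linearEquiv ((Submodule.quotEquivOfEq I (LinearMap.ker (Algebra.linearMap A B))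
    (by rw [← hker]; rfl)).trans (LinearMap.quotKerEquivOfSurjective _ hsurj))

lemma IsLocalization.mul_mem_map_iff {R A : Type*} [CommRing R] [CommRing A] [Algebra R A]
    (M : Submonoid R) [IsLocalization M A] {K Q : Ideal R} {f : R} (hf : ∀ z, z * f ∈ K ↔ z ∈ Q)
    (z : A) : z * algebraMap R A f ∈ K.map (algebraMap R A) ↔ z ∈ Q.map (algebraMap R A) := by
  obtain ⟨x, s, rfl⟩ := IsLocalization.exists_mk'_eq M z
  have h1 : IsLocalization.mk' A x s * algebraMap R A f = IsLocalization.mk' A (x * f) s := by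
    rw [mul_comm, IsLocalization.mul_mk'_eq_mk'_of_mul, mul_comm f x]
  rw [h1, IsLocalization.mk'_mem_map_algebraMap_iff, IsLocalization.mk'_mem_map_algebraMap_iff]
  simp only [← mul_assoc, hf]

variable {σ k : Type*} [Field k] {A : Type u} [CommRing A] [IsLocalRing A]
  [Algebra (MvPolynomial σ k) A]

open MvPolynomial

lemma monomialIdeal_image_Iic_succ (b : ℕ → σ →₀ ℕ) (j : ℕ) :
    monomialIdeal k (b '' Set.Iic (j + 1)) =
      monomialIdeal k (b '' Set.Iic j) ⊔ Ideal.span {monomial (b (j + 1)) 1} := by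
  have : Set.Iic (j + 1) = Set.Iic j ∪ {j + 1} := by
    ext i; simp; omega
  rw [this, Set.image_union, monomialIdeal, Set.image_union, Ideal.span_union]
  simp [monomialIdeal]

lemma DepthGE.quotient_span_monomial (M : Submonoid (MvPolynomial σ k)) [IsLocalization M A]
    {n : ℕ} (h : DepthGE A A (n + 1)) (e : σ →₀ ℕ) :
    DepthGE A (A ⧸ Ideal.span {algebraMap (MvPolynomial σ k) A (monomial e 1)}) n := by
  have h1 := IsLocalization.mul_mem_map_iff (A := A) M (K := ⊥) (Q := ⊥)
    (f := monomial e (1 : k)) (fun z => by simp)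
  rw [Ideal.map_bot] at h1
  have h2 : DepthGE A (A ⧸ (⊥ : Ideal A)) (n + 1) :=
    h.of_linearEquiv (Submodule.quotEquivOfEqBot (⊥ : Ideal A) rfl).symm
  have h3 := DepthGE.quotient_sup_span_singleton h1 h2 (h2.mono n.le_succ)
  rwa [bot_sup_eq] at h3

/-- Adjoin the generators one by one. Each colon ideal is generated by one monomial, so its quotient
loses only one unit of depth, and two units suffice in total. -/
lemma DepthGE.quotient_map_monomialIdeal (M : Submonoid (MvPolynomial σ k)) [IsLocalization M A]
    {n m : ℕ} (h : DepthGE A A (n + 2)) {par : ℕ → ℕ} {b : ℕ → σ →₀ ℕ}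
    (hpar : ∀ j < m, par j ≤ j) (hle : ∀ j < m, ∀ i ≤ j, b (par j) ≤ b i ⊔ b (j + 1)) :
    DepthGE A (A ⧸ (monomialIdeal k (b '' Set.Iic m)).map (algebraMap (MvPolynomial σ k) A)) n := by
  suffices H : ∀ i ≤ m, DepthGE A (A ⧸ (monomialIdeal k (b '' Set.Iic i)).map
      (algebraMap (MvPolynomial σ k) A)) n from H m le_rfl
  intro i
  induction i with
  | zero =>
    intro _
    have h1 := (h.quotient_span_monomial M (b 0)).mono n.le_succ
    have h2 : (Set.Iic 0 : Set ℕ) = {0} := by ext i; simp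
    rwa [h2, Set.image_singleton, monomialIdeal, Set.image_singleton, Ideal.map_span,
      Set.image_singleton]
  | succ j ih =>
    intro hj
    rw [monomialIdeal_image_Iic_succ, Ideal.map_sup, Ideal.map_span, Set.image_singleton]
    refine DepthGE.quotient_sup_span_singleton (IsLocalization.mul_mem_map_iff M fun z =>
      mul_monomial_mem_iff_of_le_sup (hpar j hj) (hle j hj)) ?_ (ih (by omega))
    rw [Ideal.map_span, Set.image_singleton]
    exact h.quotient_span_monomial M _

end Depth

/-! ### Cohen–Macaulayness of the homogenized ideal -/

section CohenMacaulay

open MvPolynomial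

lemma depthGE_localization_quotient_map {k : Type u} [Field k] {r m n : ℕ} {par : ℕ → ℕ}
    {b : ℕ → Fin r →₀ ℕ} (hpar : ∀ j < m, par j ≤ j)
    (hle : ∀ j < m, ∀ i ≤ j, b (par j) ≤ b i ⊔ b (j + 1)) (P : Ideal (MvPolynomial (Fin r) k))
    [P.IsPrime] (hn : (n + 2 : ℕ) ≤ P.height) :
    DepthGE (Localization.AtPrime P) (Localization.AtPrime P ⧸
      (monomialIdeal k (b '' Set.Iic m)).map (algebraMap _ (Localization.AtPrime P))) n := by
  have hreg : IsRegularLocalRing (Localization.AtPrime P) :=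
    IsRegularRing.isRegularLocalRing_localization _
  refine DepthGE.quotient_map_monomialIdeal P.primeCompl (depthGE_of_isRegularLocalRing _ ?_)
    hpar hle
  rw [IsLocalization.AtPrime.ringKrullDim_eq_height P]
  exact WithBot.coe_le_coe.mpr hn

lemma isCohenMacaulayLocalRing_localization_quotient {R : Type u} [CommRing R] [IsNoetherianRing R]
    {J : Ideal R} {p : Ideal (R ⧸ J)} [p.IsPrime] {n : ℕ} (hn : p.height ≤ n)
    (hd : DepthGE (Localization.AtPrime (p.comap (Ideal.Quotient.mk J)))
      (Localization.AtPrime (p.comap (Ideal.Quotient.mk J)) ⧸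
        J.map (algebraMap R (Localization.AtPrime (p.comap (Ideal.Quotient.mk J))))) n) :
    IsCohenMacaulayLocalRing (Localization.AtPrime p) := by
  let φ : Localization.AtPrime (p.comap (Ideal.Quotient.mk J)) →+* Localization.AtPrime p :=
    Localization.localRingHom _ p (Ideal.Quotient.mk J) rfl
  algebraize [φ]
  have hsurj : Function.Surjective (algebraMap (Localization.AtPrime (p.comap (Ideal.Quotient.mk J)))
      (Localization.AtPrime p)) :=
    RingHom.surjective_localRingHom_of_surjective _ Ideal.Quotient.mk_surjective p
  have hB := hd.of_surjective hsurj (Ideal.ker_localRingHom_mk J p)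
  refine hB.isCohenMacaulayLocalRing hsurj ?_
  rw [IsLocalization.AtPrime.ringKrullDim_eq_height p]
  exact WithBot.coe_le_coe.mpr hn

theorem isCohenMacaulayRing_quotient_monomialIdeal {k : Type u} [Field k] {r m : ℕ} {par : ℕ → ℕ}
    {b : ℕ → Fin r →₀ ℕ} (hpar : ∀ j < m, par j ≤ j)
    (hle : ∀ j < m, ∀ i ≤ j, b (par j) ≤ b i ⊔ b (j + 1))
    (hht : 2 ≤ (monomialIdeal k (b '' Set.Iic m)).height) :
    IsCohenMacaulayRing (MvPolynomial (Fin r) k ⧸ monomialIdeal k (b '' Set.Iic m)) := by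
  refine ⟨inferInstance, fun p _ => ?_⟩
  obtain ⟨n, hn⟩ := ENat.ne_top_iff_exists.mp (Ideal.height_ne_top (I := p) (Ideal.IsPrime.ne_top'))
  have hn2 := Ideal.height_add_height_le_height_comap_mk _ n p hn.le
  refine isCohenMacaulayLocalRing_localization_quotient hn.ge
    (depthGE_localization_quotient_map hpar hle _ (le_trans ?_ hn2))
  push_cast
  gcongr

end CohenMacaulay

/-! ### Localization at associated primes -/

section GenericallyCompleteIntersection

open IsLocalRing RingTheory.Sequence
open scoped Pointwise

/-- The class of `f` would be non-zero and killed by the whole maximal ideal, which contains an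
element regular on the quotient. -/
lemma DepthGE.not_forall_mul_mem_iff_mem_maximalIdeal {A : Type u} [CommRing A] [IsLocalRing A]
    [IsNoetherianRing A] {K : Ideal A} (h : DepthGE A (A ⧸ K) 1) (f : A) :
    ¬ ∀ z, z * f ∈ K ↔ z ∈ maximalIdeal A := by
  intro hf
  have hfK : f ∉ K := fun h1 => (maximalIdeal.isMaximal A).ne_top
    ((Ideal.eq_top_iff_one _).mpr ((hf 1).mp (by rwa [one_mul])))
  have : Nontrivial (A ⧸ K) := Ideal.Quotient.nontrivial_iff.mpr fun h1 => hfK (h1 ▸ trivial)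
  obtain ⟨rs, hl, hm, hr⟩ := h.exists_isRegular
  obtain ⟨y, rfl⟩ := List.length_eq_one_iff.mp hl
  have hreg := (isWeaklyRegular_singleton_iff _ y).mp hr.1
  exact hfK ((isSMulRegular_quotient_iff_mem_of_smul_mem K y).mp hreg f
    ((hf y).mpr (hm y (by simp))))

lemma isRegular_pair {A : Type*} [CommRing A] [IsDomain A] [IsLocalRing A] {f g : A} (hf : f ≠ 0)
    (hfm : f ∈ maximalIdeal A) (hgm : g ∈ maximalIdeal A)
    (hg : ∀ z, z * g ∈ Ideal.span {f} ↔ z ∈ Ideal.span {f}) : IsRegular A [f, g] := by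
  have hm : ∀ z ∈ [f, g], z ∈ maximalIdeal A := by simpa using ⟨hfm, hgm⟩
  refine .of_isWeaklyRegular_of_mem_maximalIdeal A hm ?_
  rw [isWeaklyRegular_cons_iff, isWeaklyRegular_singleton_iff]
  have hspan : f • (⊤ : Submodule A A) = Ideal.span {f} := by
    ext z
    rw [Submodule.mem_smul_pointwise_iff_exists, Ideal.mem_span_singleton']
    simp [mul_comm]
  refine ⟨isSMulRegular_iff_right_eq_zero_of_smul.mpr fun z hz =>
    (mul_eq_zero.mp hz).resolve_left hf, ?_⟩
  refine (isSMulRegular_quotient_iff_mem_of_smul_mem _ g).mpr fun z hz => ?_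
  rw [hspan] at hz ⊢
  rw [smul_eq_mul, mul_comm] at hz
  exact (hg z).mp hz

open MvPolynomial

lemma mul_X_pow_mem_span_X_pow_iff {σ k : Type*} [Field k] {x y : σ} (hxy : x ≠ y) (p q : ℕ)
    (z : MvPolynomial σ k) :
    z * monomial (Finsupp.single y q) 1 ∈ Ideal.span {monomial (Finsupp.single x p) (1 : k)} ↔
      z ∈ Ideal.span {monomial (Finsupp.single x p) (1 : k)} := by
  refine ⟨fun h => ?_, fun h => Ideal.mul_mem_right _ _ h⟩
  have h1 : z * monomial (Finsupp.single y q) 1 ∈ monomialIdeal k {Finsupp.single x p} := by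
    rwa [monomialIdeal, Set.image_singleton]
  have h2 := mem_monomialIdeal_of_mul_monomial_mem h1
  have h3 : Finsupp.single x p - Finsupp.single y q = Finsupp.single x p := by
    classical
    ext i
    rw [Finsupp.tsub_apply, Finsupp.single_apply, Finsupp.single_apply]
    split_ifs with h h' <;> simp_all
  rwa [Set.image_singleton, h3, monomialIdeal, Set.image_singleton] at h2

/-- The other variables are units at `P`, so the generators `c` and `d` become pure powers of `x`
and `y`; by `hS` every generator is divisible by one of these powers. -/
lemma map_monomialIdeal_eq_span_pair {σ k A : Type*} [Field k] [CommRing A] [IsLocalRing A]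
    [Algebra (MvPolynomial σ k) A] {P : Ideal (MvPolynomial σ k)} [P.IsPrime]
    [IsLocalization.AtPrime A P] {x y : σ} (hP : P = varIdeal k {x, y}) {S : Set (σ →₀ ℕ)}
    {c d : σ →₀ ℕ} (hc : c ∈ S) (hd : d ∈ S) (hcy : c y = 0) (hdx : d x = 0)
    (hS : ∀ e ∈ S, c x ≤ e x ∨ d y ≤ e y) :
    (monomialIdeal k S).map (algebraMap (MvPolynomial σ k) A) =
      Ideal.span {algebraMap (MvPolynomial σ k) A (monomial (Finsupp.single x (c x)) 1),
        algebraMap (MvPolynomial σ k) A (monomial (Finsupp.single y (d y)) 1)} := by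
  classical
  have key : ∀ e ∈ S, ∀ z, (∀ i ∈ ({x, y} : Set σ), e.erase z i = 0) →
      algebraMap (MvPolynomial σ k) A (monomial (Finsupp.single z (e z)) 1) ∈
        (monomialIdeal k S).map (algebraMap (MvPolynomial σ k) A) := by
    intro e he z hz
    have h1 : monomial e (1 : k) = monomial (Finsupp.single z (e z)) 1 * monomial (e.erase z) 1 := by
      rw [monomial_mul, one_mul, Finsupp.single_add_erase]
    have h2 : IsUnit (algebraMap (MvPolynomial σ k) A (monomial (e.erase z) 1)) := by
      refine IsLocalization.map_units A (⟨_, ?_⟩ : P.primeCompl)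
      intro h3
      rw [SetLike.mem_coe, hP, monomial_mem_varIdeal] at h3
      obtain ⟨i, hi, h4⟩ := h3
      exact h4 (hz i hi)
    have h3 := Ideal.mem_map_of_mem (algebraMap (MvPolynomial σ k) A)
      (monomial_mem_monomialIdeal.mpr ⟨e, he, le_rfl⟩ : monomial e (1 : k) ∈ monomialIdeal k S)
    rw [h1, map_mul] at h3
    exact (Ideal.mul_unit_mem_iff_mem _ h2).mp h3
  apply le_antisymm
  · rw [monomialIdeal, Ideal.map_span, Ideal.span_le]
    rintro _ ⟨_, ⟨e, he, rfl⟩, rfl⟩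
    have hdvd : ∀ z n, n ≤ e z → monomial (Finsupp.single z n) (1 : k) ∣ monomial e 1 := by
      intro z n hn
      refine ⟨monomial (e - Finsupp.single z n) 1, ?_⟩
      rw [monomial_mul, one_mul, add_tsub_cancel_of_le (Finsupp.single_le_iff.mpr hn)]
    rcases hS e he with h | h
    · exact Ideal.mem_of_dvd _ (map_dvd _ (hdvd x _ h)) (Ideal.subset_span (by simp))
    · exact Ideal.mem_of_dvd _ (map_dvd _ (hdvd y _ h)) (Ideal.subset_span (by simp))
  · rw [Ideal.span_le, Set.insert_subset_iff, Set.singleton_subset_iff]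
    refine ⟨key c hc x fun i hi => ?_, key d hd y fun i hi => ?_⟩ <;>
    rcases hi with rfl | rfl <;> simp [Finsupp.erase_apply, hcy, hdx]

theorem isGenericallyCompleteIntersection_monomialIdeal {k : Type u} [Field k] {r m : ℕ}
    {par : ℕ → ℕ} {a u w b : ℕ → Fin r →₀ ℕ}
    (hT : ∀ x, IsExponentTree m par (a · x) (u · x) (w · x) (b · x)) (hpar : ∀ j < m, par j ≤ j)
    (hle : ∀ j < m, ∀ i ≤ j, b (par j) ≤ b i ⊔ b (j + 1))
    (hht : 2 ≤ (monomialIdeal k (b '' Set.Iic m)).height) :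
    IsGenericallyCompleteIntersection (monomialIdeal k (b '' Set.Iic m)) := by
  classical
  intro P _ hP
  obtain ⟨-, f, hf⟩ := isAssociatedPrime_iff.mp hP
  obtain ⟨f, rfl⟩ := Ideal.Quotient.mk_surjective f
  have hcolon : ∀ z, z * f ∈ monomialIdeal k (b '' Set.Iic m) ↔ z ∈ P := fun z => by
    rw [hf, Submodule.mem_colon_singleton, Submodule.mem_bot, ← Ideal.Quotient.eq_zero_iff_mem,
      map_mul]
    rfl
  have hJP : monomialIdeal k (b '' Set.Iic m) ≤ P := fun z hz =>
    (hcolon z).mp (Ideal.mul_mem_right _ _ hz)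
  -- In height at least three the localized quotient has positive depth, so its maximal ideal is not
  -- associated.
  have hP2 : P.height ≤ 2 := by
    by_contra! h3
    have h3' : ((1 + 2 : ℕ) : ℕ∞) ≤ P.height := Order.add_one_le_of_lt h3
    refine (depthGE_localization_quotient_map (k := k) hpar hle P
      h3').not_forall_mul_mem_iff_mem_maximalIdeal (algebraMap _ _ f) fun z => ?_
    rw [← Localization.AtPrime.map_eq_maximalIdeal]
    exact IsLocalization.mul_mem_map_iff P.primeCompl hcolon z
  have hmin := Ideal.mem_minimalPrimes_of_height_le hJP (hP2.trans hht)
  have hvar := eq_varIdeal_of_mem_minimalPrimes hmin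
  obtain ⟨W, hW⟩ : ∃ W : Finset (Fin r), (W : Set (Fin r)) = {i | (X i : MvPolynomial (Fin r) k) ∈ P} :=
    ⟨Finset.univ.filter fun i => X i ∈ P, by ext; simp⟩
  rw [← hW] at hvar
  have hcard : W.card = 2 := by
    have h1 := height_varIdeal (k := k) W
    rw [← hvar, le_antisymm hP2 (hht.trans (Ideal.height_mono hJP))] at h1
    exact_mod_cast h1.symm
  obtain ⟨x, y, hxy, rfl⟩ := Finset.card_eq_two.mp hcard
  rw [Finset.coe_pair] at hvar
  have hJW := hJP
  rw [hvar, monomialIdeal_le_varIdeal_iff] at hJW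
  have hne : ∀ i ≤ m, b i x = 0 → b i y ≠ 0 := by
    intro i hi h0
    obtain ⟨z, hz, h1⟩ := hJW _ ⟨i, hi, rfl⟩
    rcases hz with rfl | rfl
    · exact absurd h0 h1
    · exact h1
  obtain ⟨s, hs, t, ht, hsx, hty, hst⟩ := (hT x).exists_corners (hT y) fun i hi h0 h1 =>
    hne i hi (((hT x).eq_zero_iff hi).mpr h0) (((hT y).eq_zero_iff hi).mpr h1)
  have hmap := map_monomialIdeal_eq_span_pair (A := Localization.AtPrime P) hvar
    (S := b '' Set.Iic m) ⟨t, ht, rfl⟩ ⟨s, hs, rfl⟩ hty hsx (by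
      rintro _ ⟨i, hi, rfl⟩; exact hst i hi)
  have hmem : ∀ z ∈ ({x, y} : Set (Fin r)), ∀ n ≠ 0,
      algebraMap _ (Localization.AtPrime P) (monomial (Finsupp.single z n) (1 : k)) ∈
        maximalIdeal (Localization.AtPrime P) := by
    intro z hz n hn
    rw [← Localization.AtPrime.map_eq_maximalIdeal]
    refine Ideal.mem_map_of_mem _ ?_
    rw [hvar, monomial_mem_varIdeal]
    exact ⟨z, hz, by simpa using hn⟩
  have hinj : Function.Injective (algebraMap (MvPolynomial (Fin r) k) (Localization.AtPrime P)) :=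
    IsLocalization.injective _ P.primeCompl_le_nonZeroDivisors
  refine ⟨_, isRegular_pair ?_ (hmem x (by simp) (b t x) fun h => hne t ht h hty)
    (hmem y (by simp) (b s y) (hne s hs hsx)) fun z => ?_, ?_⟩
  · rw [map_ne_zero_iff _ hinj]
    simp
  · have h1 := IsLocalization.mul_mem_map_iff (A := Localization.AtPrime P) P.primeCompl
      (mul_X_pow_mem_span_X_pow_iff (k := k) hxy (b t x) (b s y)) z
    rwa [Ideal.map_span, Set.image_singleton] at h1
  · rw [hmap, Ideal.ofList_cons, Ideal.ofList_singleton, Ideal.span_insert]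

end GenericallyCompleteIntersection

/-! ### Conclusion -/

lemma Ideal.height_radical_eq {R : Type*} [CommRing R] (I : Ideal R) :
    I.radical.height = I.height := by
  simp only [Ideal.height, Ideal.radical_minimalPrimes]

theorem corollary3p3 {k : Type*} [Field k] {r : ℕ} (I : Ideal (MvPolynomial (Fin r) k))
    (hmon : IsMonomialIdeal I) (hcodim : I.height = 2)
    (hCM : IsCohenMacaulayRing (MvPolynomial (Fin r) k ⧸ I)) :
    ∃ J : Ideal (MvPolynomial (Fin r) k),
      IsMonomialIdeal J ∧
      J.radical = I.radical ∧
      IsCohenMacaulayRing (MvPolynomial (Fin r) k ⧸ J) ∧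
      IsGenericallyCompleteIntersection J ∧
      (∃ d : ℕ, ∀ e ∈ minimalMonomialGenerators J, e.degree = d) ∧
      ∃ (m : ℕ) (φ ψ : Matrix (Fin (m + 1)) (Fin m) (MvPolynomial (Fin r) k)),
        IsHilbertBurchMatrix φ I.radical ∧
        HasTwoMonomialColumns φ ∧
        IsColumnHomogenization φ ψ ∧
        J = maximalMinorsIdeal ψ := by
  obtain ⟨m, par, a, hpar, ha, hle, hanti, hrad⟩ := exists_ordered_tree hmon hcodim hCM
  have hht : I.radical.height = 2 := by rw [Ideal.height_radical_eq, hcodim]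
  have h0 : ∀ x, ∃ i ≤ m, a i x = 0 :=
    exists_apply_eq_zero_of_two_le_height (k := k) (T := Set.Iic m) (by rw [← hrad, hht])
  obtain ⟨u, w, b, hT, ⟨d, hd⟩, hu, hw⟩ := exists_homogenized_tree hpar ha hle hanti h0
  -- The same recursion with the unraised entries; by `minor_eq` it returns the squarefree
  -- generators `a`, so the unhomogenized matrix is the Hilbert–Burch matrix of the radical.
  have hT' := isExponentTree_of_squarefree hpar ha hle h0 (u := fun j => a (par j) - a (j + 1))
    (w := fun j => a (j + 1) - a (par j)) (fun _ _ => rfl) fun _ _ => rfl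
  have hb0 : b 0 = ∑ j ∈ Finset.range m, u j := by
    ext x; rw [Finsupp.finsetSum_apply]; exact (hT x).base
  have hb : ∀ j < m, b (j + 1) + u j = b (par j) + w j := fun j hj =>
    Finsupp.ext fun x => (hT x).add_eq hj
  have hble : ∀ j < m, ∀ i ≤ j, b (par j) ≤ b i ⊔ b (j + 1) := fun j hj i hi x =>
    (hT x).minor_le_max hj hi
  have hJrad : (monomialIdeal k (b '' Set.Iic m)).radical = I.radical := by
    rw [radical_monomialIdeal, hrad, Set.image_image]
    congr 1
    refine Set.image_congr fun i hi => Finsupp.ext fun x => ?_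
    have h1 := (hT x).eq_zero_iff (i := i) hi
    have h2 := ha i x
    rw [radicalExponent_apply]
    omega
  have hJht : 2 ≤ (monomialIdeal k (b '' Set.Iic m)).height := by
    rw [← Ideal.height_radical_eq, hJrad, hht]
  refine ⟨monomialIdeal k (b '' Set.Iic m), ⟨_, rfl⟩, hJrad,
    isCohenMacaulayRing_quotient_monomialIdeal hpar hble hJht,
    isGenericallyCompleteIntersection_monomialIdeal hT hpar hble hJht,
    ⟨d, fun e he => ?_⟩, m, treeMatrix k m par (fun j => a (par j) - a (j + 1))
      (fun j => a (j + 1) - a (par j)), treeMatrix k m par u w, ?_,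
    hasTwoMonomialColumns_treeMatrix hpar, isColumnHomogenization_treeMatrix hpar hu hw,
    (maximalMinorsIdeal_treeMatrix hpar hb0 hb).symm⟩
  · have he' : Minimal (fun e' => MvPolynomial.monomial e' (1 : k) ∈ monomialIdeal k (b '' Set.Iic m)) e :=
      he
    obtain ⟨_, ⟨i, hi, rfl⟩, hie⟩ := monomial_mem_monomialIdeal.mp he'.prop
    rw [he'.eq_of_ge (monomial_mem_monomialIdeal.mpr ⟨_, ⟨i, hi, rfl⟩, le_rfl⟩) hie]
    exact hd i hi
  · have h1 : ∀ i ≤ m, treeRec (∑ j ∈ Finset.range m, (a (par j) - a (j + 1)))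
        (fun j c => c + (a (j + 1) - a (par j)) - (a (par j) - a (j + 1))) par i = a i :=
      fun i hi => Finsupp.ext fun x => (hT' x).minor_eq (fun _ _ => rfl) (fun _ _ => rfl) hi
    have h2 : a 0 = ∑ j ∈ Finset.range m, (a (par j) - a (j + 1)) := by
      rw [← h1 0 (Nat.zero_le _), treeRec_zero]
    rw [hrad]
    refine isHilbertBurchMatrix_treeMatrix hpar h2 (fun j hj => ?_) (fun _ _ => rfl) hle hanti
    ext x
    simp only [Finsupp.add_apply, Finsupp.tsub_apply]
    omega
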